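/- Let $d,N\ge 1$ be integers and $s\in(0,\infty)$. Put $D=\{1,\dots,N\}^d\subset\mathbb Z^d$, let $\partial D$ be the set of points of $\mathbb Z^d\setminus D$ at Euclidean distance $1$ from some point of $D$, put $\overline D=D\cup\partial D$ and $\Omega=[0,\infty)^{D}$, and extend $\phi\in\Omega$ to $\overline D$ by $\phi_x=0$ for $x\in\partial D$. For $V:\mathbb R\to\mathbb R$ let $$H(\phi)=\tfrac12\sum_{x,y\in\overline D,\ |x-y|=1}V(\phi_x-\phi_y),\qquad d\mu(\phi)=\frac1Z\,e^{-H(\phi)}\prod_{x\in D}\bigl(s\,d\delta_0(\phi_x)+d\phi_x\bigr),\quad \phi\in\Omega,$$ where $d\phi_x$ is Lebesgue measure on $[0,\infty)$ and $Z$ is the normalizing constant. Assume that $V$ is continuously differentiable, bounded below and symmetric ($V(-r)=V(r)$), that $\int_{\mathbb R}e^{-V(r)}\,dr<\infty$, and that for every $x\in D$ the function $\phi\mapsto\sum_{y\in\overline D,\,|x-y|=1}V'(\phi_x-\phi_y)$ belongs to $L^2(\Omega;\mu)$. For $B\subset D$ let $\mu_B$ be the restriction of $\mu$ to $\{\phi\in\Omega:\phi_x>0\Leftrightarrow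 x\in B\}$. Let $C_c^2(\Omega)$ be the space of continuous functions $F:\Omega\to\mathbb R$ with compact support that are twice continuously differentiable on $(0,\infty)^D$ and whose partial derivatives of order at most $2$ extend continuously to $\Omega$; $\partial_xF$ denotes the continuous extension to $\Omega$ of the partial derivative in the variable $\phi_x$. Then $\mu$ is a probability measure, and $$\mathcal E(F,G)=\sum_{\varnothing\ne B\subset D}\ \sum_{x\in B}\int\partial_xF\,\partial_xG\,d\mu_B,\qquad F,G\in C_c^2(\Omega),$$ is a well-defined, densely defined, symmetric bilinear form on $L^2(\Omega;\mu)$ which is positive ($\mathcal E(F,F)\ge0$) and closable. Its closure is a conservative, strongly local, regular, symmetric Dirichlet form on $L^2(\Omega;\mu)$. Here a symmetric Dirichlet form is a densely defined, symmetric, positive, closed form on which the unit contraction $u\mapsto(u\vee0)\wedge1$ operates. Regular means that $\mu$ has full support and that $D(\mathcal E)\cap C_c(\Omega)$ is dense in $D(\mathcal E)$ for the norm of $\mathcal E_1=\mathcal E+(\cdot,\cdot)_{L^2}$ and uniformly dense in $C_c(\Omega)$. Strongly local means that $\mathcal E(u,v)=0$ if $u,v\in D(\mathcal E)$ have compact supports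 and $v$ is constant on a neighbourhood of the support of $u$. Conservative means that $1\in D(\mathcal E)$, $\mathcal E(1,1)=0$, and the associated $L^2$-semigroup satisfies $T_t1=1$ for all $t\ge0$. -/

import Mathlib

open MeasureTheory Filter Topology Set
open scoped NNReal ENNReal CompactlySupported

noncomputable section

namespace Wetting

/-! ### Symmetric forms and Dirichlet forms on `L²(X; μ)` -/

/-- A bilinear form on `L²(X; μ)` defined on a linear subspace. -/
structure L2Form {X : Type*} [MeasurableSpace X] (μ : Measure X) where
  domain : Submodule ℝ (Lp ℝ 2 μ)
  form : LinearMap.BilinForm ℝ domain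

namespace L2Form

section Basic

variable {X : Type*} [MeasurableSpace X] {μ : Measure X} (𝓔 : L2Form μ)

/-- The quadratic form `𝓔₁(u, u) = 𝓔(u, u) + ‖u‖²`. -/
def energyOne (u : 𝓔.domain) : ℝ := 𝓔.form u u + ‖(u : Lp ℝ 2 μ)‖ ^ 2

def IsDenselyDefined : Prop := Dense (𝓔.domain : Set (Lp ℝ 2 μ))

def IsSymm : Prop := ∀ u v : 𝓔.domain, 𝓔.form u v = 𝓔.form v u

/-- Positivity, `𝓔(u, u) ≥ 0`. -/
def IsPositive : Prop := ∀ u : 𝓔.domain, 0 ≤ 𝓔.form u u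

/-- `(u k)` is a Cauchy sequence with respect to `𝓔`. -/
def IsCauchy (u : ℕ → 𝓔.domain) : Prop :=
  Tendsto (fun p : ℕ × ℕ => 𝓔.form (u p.1 - u p.2) (u p.1 - u p.2)) atTop (𝓝 0)

/-- Closability on `L²(X; μ)`. -/
def IsClosable : Prop :=
  ∀ u : ℕ → 𝓔.domain, 𝓔.IsCauchy u →
    Tendsto (fun k => (u k : Lp ℝ 2 μ)) atTop (𝓝 0) →
    Tendsto (fun k => 𝓔.form (u k) (u k)) atTop (𝓝 0)

/-- Closedness: the domain is complete with respect to `𝓔₁`. -/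
def IsClosedForm : Prop :=
  ∀ u : ℕ → 𝓔.domain,
    Tendsto (fun p : ℕ × ℕ => 𝓔.energyOne (u p.1 - u p.2)) atTop (𝓝 0) →
    ∃ v : 𝓔.domain, Tendsto (fun k => 𝓔.energyOne (u k - v)) atTop (𝓝 0)

/-- `𝓕` is the closure of `𝓔`: a closed extension in whose domain the domain of `𝓔` is
`𝓕₁`-dense. -/
structure IsClosureOf (𝓕 𝓔 : L2Form μ) : Prop where
  le : 𝓔.domain ≤ 𝓕.domain
  form_eq : ∀ u v : 𝓔.domain,
    𝓕.form (Submodule.inclusion le u) (Submodule.inclusion le v) = 𝓔.form u v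
  closed : 𝓕.IsClosedForm
  dense : ∀ u : 𝓕.domain, ∃ w : ℕ → 𝓔.domain,
    Tendsto (fun k => 𝓕.energyOne (u - Submodule.inclusion le (w k))) atTop (𝓝 0)

/-- The Markov property: the unit contraction operates on the form. -/
def IsMarkovian : Prop :=
  ∀ (u : 𝓔.domain) (v : Lp ℝ 2 μ),
    (∀ᵐ x ∂μ, v x = min (max ((u : Lp ℝ 2 μ) x) 0) 1) →
    ∃ hv : v ∈ 𝓔.domain, 𝓔.form ⟨v, hv⟩ ⟨v, hv⟩ ≤ 𝓔.form u u

/-- Symmetric Dirichlet forms on `L²(X; μ)`. -/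
structure IsSymmDirichletForm : Prop where
  denselyDefined : 𝓔.IsDenselyDefined
  symm : 𝓔.IsSymm
  positive : 𝓔.IsPositive
  closed : 𝓔.IsClosedForm
  markovian : 𝓔.IsMarkovian

/-- A strongly continuous contraction semigroup of symmetric operators `T t`, `t ≥ 0`. -/
structure IsSymmSemigroup (T : ℝ → (Lp ℝ 2 μ →L[ℝ] Lp ℝ 2 μ)) : Prop where
  zero : ∀ f, T 0 f = f
  add : ∀ s t, 0 ≤ s → 0 ≤ t → ∀ f, T (s + t) f = T s (T t f)
  contraction : ∀ t, 0 ≤ t → ∀ f, ‖T t f‖ ≤ ‖f‖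
  symm : ∀ t, 0 ≤ t → ∀ f g, inner ℝ (T t f) g = inner ℝ f (T t g)
  continuous : ∀ f, Tendsto (fun t => T t f) (𝓝[>] 0) (𝓝 f)

/-- `T` is the `L²`-semigroup of `𝓔`: with the approximating forms
`𝓔⁽ᵗ⁾(u, v) = t⁻¹ (u - T t u, v)`, the domain of `𝓔` consists of those `u` for which
`𝓔⁽ᵗ⁾(u, u)` is bounded in `t > 0`, and `𝓔⁽ᵗ⁾ → 𝓔` on it as `t ↓ 0`. -/
structure IsSemigroupOf (T : ℝ → (Lp ℝ 2 μ →L[ℝ] Lp ℝ 2 μ)) : Prop where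
  semigroup : IsSymmSemigroup T
  mem_domain : ∀ u : Lp ℝ 2 μ,
    u ∈ 𝓔.domain ↔ ∃ C : ℝ, ∀ t : ℝ, 0 < t → t⁻¹ * inner ℝ (u - T t u) u ≤ C
  form_eq : ∀ u v : 𝓔.domain,
    Tendsto (fun t : ℝ => t⁻¹ * inner ℝ ((u : Lp ℝ 2 μ) - T t u) (v : Lp ℝ 2 μ))
      (𝓝[>] 0) (𝓝 (𝓔.form u v))

/-- Conservativity of a form over a finite measure: the constant function `1` belongs to the
domain and has zero energy, and the semigroup of the form satisfies `T t 1 = 1`. -/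
def IsConservative : Prop :=
  ∃ e : 𝓔.domain, (∀ᵐ x ∂μ, (e : Lp ℝ 2 μ) x = 1) ∧ 𝓔.form e e = 0 ∧
    ∀ T : ℝ → (Lp ℝ 2 μ →L[ℝ] Lp ℝ 2 μ), 𝓔.IsSemigroupOf T →
      ∀ t : ℝ, 0 ≤ t → T t (e : Lp ℝ 2 μ) = e

end Basic

section Topological

variable {X : Type*} [TopologicalSpace X] [MeasurableSpace X] {μ : Measure X} (𝓔 : L2Form μ)

/-- The support of the measure `|u| μ`: the complement of the largest open set on which `u`
vanishes almost everywhere. -/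
def supp (u : Lp ℝ 2 μ) : Set X :=
  {x | ∀ U : Set X, IsOpen U → x ∈ U → ¬ ∀ᵐ y ∂μ, y ∈ U → u y = 0}

/-- The continuous compactly supported function `f` represents an element of the domain. -/
def Represents (u : 𝓔.domain) (f : C_c(X, ℝ)) : Prop := ∀ᵐ x ∂μ, (u : Lp ℝ 2 μ) x = f x

/-- Regularity: `μ` has full support, and `D(𝓔) ∩ C_c(X)` is `𝓔₁`-dense in `D(𝓔)` and
uniformly dense in `C_c(X)`. -/
structure IsRegular : Prop where
  fullSupport : μ.IsOpenPosMeasure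
  dense_domain : ∀ (u : 𝓔.domain) (ε : ℝ), 0 < ε →
    ∃ (v : 𝓔.domain) (f : C_c(X, ℝ)), 𝓔.Represents v f ∧ 𝓔.energyOne (u - v) < ε
  dense_continuous : ∀ (f : C_c(X, ℝ)) (ε : ℝ), 0 < ε →
    ∃ (v : 𝓔.domain) (g : C_c(X, ℝ)), 𝓔.Represents v g ∧ ∀ x, |f x - g x| < ε

/-- The strong local property: `𝓔(u, v) = 0` whenever `u` and `v` have compact support and
`v` is constant on a neighbourhood of the support of `u`. -/
def IsStronglyLocal : Prop :=
  ∀ u v : 𝓔.domain, IsCompact (supp (u : Lp ℝ 2 μ)) → IsCompact (supp (v : Lp ℝ 2 μ)) →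
    (∃ (U : Set X) (c : ℝ), IsOpen U ∧ supp (u : Lp ℝ 2 μ) ⊆ U ∧
      ∀ᵐ x ∂μ, x ∈ U → (v : Lp ℝ 2 μ) x = c) →
    𝓔.form u v = 0

end Topological

end L2Form

/-! ### Functions on the orthant `[0, ∞)^ι` -/

section Orthant

variable {ι : Type*}

/-- The open orthant `(0, ∞)^ι` inside `[0, ∞)^ι`. -/
def openOrthant (ι : Type*) : Set (ι → ℝ≥0) := {φ | ∀ x, 0 < φ x}

/-- `F` read as a function on `ℝ^ι`; only its values on the open orthant matter below. -/
def lift (F : (ι → ℝ≥0) → ℝ) (u : ι → ℝ) : ℝ := F fun x => (u x).toNNReal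

variable [Fintype ι] [DecidableEq ι]

/-- `C_c^k([0, ∞)^ι)`: continuous functions with compact support that are `k`-times continuously
differentiable in the open orthant and all of whose partial derivatives of order at most `k`
extend continuously to `[0, ∞)^ι`. -/
structure IsCc (k : ℕ) (F : (ι → ℝ≥0) → ℝ) : Prop where
  continuous : Continuous F
  compactSupport : HasCompactSupport F
  contDiffOn : ContDiffOn ℝ k (lift F) {u : ι → ℝ | ∀ x, 0 < u x}
  extends_deriv : ∀ l ≤ k, ∀ v : Fin l → ι, ∃ g : (ι → ℝ≥0) → ℝ, Continuous g ∧
    ∀ φ ∈ openOrthant ι, g φ =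
      iteratedFDeriv ℝ l (lift F) (fun x => (φ x : ℝ)) (fun j => Pi.single (v j) 1)

/-- The partial derivative `∂_x F` on `[0, ∞)^ι`: the continuous extension of the partial
derivative in the open orthant. -/
def pderiv (x : ι) (F : (ι → ℝ≥0) → ℝ) : (ι → ℝ≥0) → ℝ :=
  extendFrom (openOrthant ι)
    fun φ => fderiv ℝ (lift F) (fun y => (φ y : ℝ)) (Pi.single x 1)

end Orthant

/-! ### The lattice, the Hamiltonian and the pinned Gibbs measure -/

/-- Nearest neighbours in `ℤ^d`: Euclidean distance `1`. -/
def Nbr {d : ℕ} (x y : Fin d → ℤ) : Prop := ∑ i, (x i - y i) ^ 2 = 1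

instance {d : ℕ} (x y : Fin d → ℤ) : Decidable (Nbr x y) :=
  inferInstanceAs (Decidable (_ = _))

/-- `D_{d,N} = {1, …, N}^d`. -/
def box (d N : ℕ) : Finset (Fin d → ℤ) := Fintype.piFinset fun _ => Finset.Icc 1 (N : ℤ)

/-- The boundary of `D_{d,N}`: the points outside `D_{d,N}` with a nearest neighbour in
`D_{d,N}`. They all lie in `{0, …, N + 1}^d`; see `mem_boundary`. -/
def boundary (d N : ℕ) : Finset (Fin d → ℤ) :=
  (Fintype.piFinset fun _ => Finset.Icc 0 (N + 1 : ℤ)).filter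
    fun x => x ∉ box d N ∧ ∃ y ∈ box d N, Nbr x y

theorem mem_boundary {d N : ℕ} (x : Fin d → ℤ) :
    x ∈ boundary d N ↔ x ∉ box d N ∧ ∃ y ∈ box d N, Nbr x y := by
  unfold boundary
  rw [Finset.mem_filter, and_iff_right_iff_imp]
  rintro ⟨-, y, hy, hxy⟩
  rw [Fintype.mem_piFinset]
  intro i
  have hyi := Finset.mem_Icc.1 (Fintype.mem_piFinset.1 hy i)
  have h1 : (x i - y i) ^ 2 ≤ 1 := by
    rw [← (show ∑ i, (x i - y i) ^ 2 = 1 from hxy)]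
    exact Finset.single_le_sum (f := fun i => (x i - y i) ^ 2)
      (fun j _ => sq_nonneg _) (Finset.mem_univ i)
  have h2 := abs_le.1 ((sq_le_one_iff_abs_le_one _).1 h1)
  rw [Finset.mem_Icc]
  omega

/-- The closure of `D_{d,N}`. -/
def closedBox (d N : ℕ) : Finset (Fin d → ℤ) := box d N ∪ boundary d N

/-- The space of interfaces `[0, ∞)^{D_{d,N}}`. -/
abbrev Interface (d N : ℕ) : Type := ↥(box d N) → ℝ≥0

/-- The height of an interface, with zero boundary condition. -/
def height {d N : ℕ} (φ : Interface d N) (x : Fin d → ℤ) : ℝ :=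
  if h : x ∈ box d N then (φ ⟨x, h⟩ : ℝ) else 0

/-- The Hamiltonian with pair potential `V` and zero boundary condition. -/
def hamiltonian (d N : ℕ) (V : ℝ → ℝ) (φ : Interface d N) : ℝ :=
  1 / 2 * ∑ x ∈ closedBox d N, ∑ y ∈ (closedBox d N).filter (fun y => Nbr x y),
    V (height φ x - height φ y)

/-- Lebesgue measure on `[0, ∞)`. -/
def halfLineLebesgue : Measure ℝ≥0 := Measure.comap ((↑) : ℝ≥0 → ℝ) volume

/-- The reference measure `∏_x (s δ₀ + dφ_x)` on `[0, ∞)^{D_{d,N}}`. -/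
def refMeasure (d N : ℕ) (s : ℝ) : Measure (Interface d N) :=
  Measure.pi fun _ => ENNReal.ofReal s • Measure.dirac (0 : ℝ≥0) + halfLineLebesgue

/-- The normalizing constant. -/
def partitionFunction (d N : ℕ) (s : ℝ) (V : ℝ → ℝ) : ℝ≥0∞ :=
  ∫⁻ φ, ENNReal.ofReal (Real.exp (-hamiltonian d N V φ)) ∂(refMeasure d N s)

/-- The pinned Gibbs measure. -/
def gibbs (d N : ℕ) (s : ℝ) (V : ℝ → ℝ) : Measure (Interface d N) :=
  (refMeasure d N s).withDensity fun φ =>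
    ENNReal.ofReal (Real.exp (-hamiltonian d N V φ)) / partitionFunction d N s V

/-- The interfaces whose wet region `{x | φ_x > 0}` is exactly `B`. -/
def wet {d N : ℕ} (B : Finset ↥(box d N)) : Set (Interface d N) :=
  {φ | ∀ x, 0 < φ x ↔ x ∈ B}

/-- The restriction `μ_B` of the Gibbs measure to the interfaces with wet region `B`. -/
def gibbsOn (d N : ℕ) (s : ℝ) (V : ℝ → ℝ) (B : Finset ↥(box d N)) :
    Measure (Interface d N) :=
  (gibbs d N s V).restrict (wet B)

/-- The function `𝕍'(x, φ) = ∑_{|x-y|=1} V'(φ_x - φ_y)`. -/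
def potentialDrift (d N : ℕ) (V : ℝ → ℝ) (x : Fin d → ℤ) (φ : Interface d N) : ℝ :=
  ∑ y ∈ (closedBox d N).filter (fun y => Nbr x y), deriv V (height φ x - height φ y)

/-- The assumptions on the pair potential. -/
structure IsPairPotential (d N : ℕ) (s : ℝ) (V : ℝ → ℝ) : Prop where
  bounded_below : ∃ b : ℝ, 0 ≤ b ∧ ∀ r, -b ≤ V r
  contDiff : ContDiff ℝ 1 V
  symm : ∀ r, V (-r) = V r
  integrable : Integrable fun r => Real.exp (-V r)
  drift_memLp : ∀ x ∈ box d N, MemLp (potentialDrift d N V x) 2 (gibbs d N s V)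

/-- The value `∑_{∅ ≠ B ⊆ D_{d,N}} ∑_{x ∈ B} ∫ ∂_x F ∂_x G dμ_B`. -/
def wettingEnergy (d N : ℕ) (s : ℝ) (V : ℝ → ℝ) (F G : Interface d N → ℝ) : ℝ :=
  ∑ B ∈ (Finset.univ : Finset (Finset ↥(box d N))).filter (fun B => B.Nonempty),
    ∑ x ∈ B, ∫ φ, pderiv x F φ * pderiv x G φ ∂(gibbsOn d N s V B)

/-- `𝓔` is the bilinear form on `L²` of the Gibbs measure whose domain is (the set of classes of)
`C_c^2([0, ∞)^{D_{d,N}})` and which is given there by `wettingEnergy`. -/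
structure IsWettingForm (d N : ℕ) (s : ℝ) (V : ℝ → ℝ) (𝓔 : L2Form (gibbs d N s V)) :
    Prop where
  memLp : ∀ F : Interface d N → ℝ, IsCc 2 F → MemLp F 2 (gibbs d N s V)
  mem_domain : ∀ u : Lp ℝ 2 (gibbs d N s V),
    u ∈ 𝓔.domain ↔ ∃ F : Interface d N → ℝ, IsCc 2 F ∧ u =ᵐ[gibbs d N s V] F
  integrable : ∀ F G : Interface d N → ℝ, IsCc 2 F → IsCc 2 G →
    ∀ B : Finset ↥(box d N), ∀ x ∈ B,
      Integrable (fun φ => pderiv x F φ * pderiv x G φ) (gibbsOn d N s V B)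
  form_eq : ∀ F G : Interface d N → ℝ, IsCc 2 F → IsCc 2 G →
    ∀ u v : 𝓔.domain, (u : Lp ℝ 2 (gibbs d N s V)) =ᵐ[gibbs d N s V] F →
      (v : Lp ℝ 2 (gibbs d N s V)) =ᵐ[gibbs d N s V] G →
      𝓔.form u v = wettingEnergy d N s V F G

end Wetting

end

/-! For fixed `x`, the sets `wet B` with `x ∈ B` partition `{φ_x > 0}`. Exchanging the two sums
therefore turns the energy into `∑ x, ∫_{φ_x > 0} ∂_x F ∂_x G dμ`. This is `⟪∇F, ∇G⟫` for the
gradient from `C_c^2 ⊆ L²(μ)` to the Hilbert sum over `x` of `L²({φ_x > 0}; μ)`. Symmetry and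
positivity are then immediate, and closability says that the closure of the graph of `∇` is again a
graph.

The key is integration by parts in one variable, `integral_grad_mul`. The test functions vanish on
`{φ_x = 0}`, so neither the atom at `0` nor a boundary term contributes. They are divided by the
density `ρ` of `μ`, so `ρ` is never differentiated. Such test functions determine a square
integrable function on `{φ_x > 0}`. Hence an element of the closed graph whose first component is
constant on an open set has zero gradient there (`grad_eq_zero_of_const`). The constant `0` on the
whole space gives closability, and general open sets give strong locality.

Markov property: the unit contraction is a limit of smooth `j` with `|j'| ≤ 1`, which do not
increase gradient norms. The bound passes to the limit because closed subspaces are weakly closed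
and the norm is weakly lower semicontinuous (`exists_mem_of_bounded`).

Conservativity: slowly varying cutoffs put `(1, 0)` in the closed graph (`one_mem_closure`), and a
vector of zero energy is fixed by the semigroup.

Finiteness of `Z`: only the bonds from `x` to `x - e` are kept, for one unit vector `e`. The heights
are integrated out in decreasing order of the corresponding coordinate, each at a bounded cost
(`lmarginal_prod_le`). -/

noncomputable section

namespace Wetting

/-! ### Forms given by the graph of a closable operator -/

section Weak

variable {M : Type*} [NormedAddCommGroup M] [InnerProductSpace ℝ M] [CompleteSpace M]

/-- A bounded sequence in a Hilbert space converges weakly along every ultrafilter. -/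
theorem exists_weak_limit (U : Ultrafilter ℕ) (z : ℕ → M) (C : ℝ) (hz : ∀ n, ‖z n‖ ≤ C) :
    ∃ w : M, ∀ y, Tendsto (fun n => inner ℝ (z n) y) U (𝓝 (inner ℝ w y)) := by
  have hb : ∀ y n, |inner ℝ (z n) y| ≤ C * ‖y‖ := fun y n =>
    (abs_real_inner_le_norm _ _).trans (by gcongr; exact hz n)
  have key : ∀ y, ∃ l : ℝ, Tendsto (fun n => inner ℝ (z n) y) U (𝓝 l) := by
    intro y
    -- Each scalar sequence stays in a compact interval, so it converges along `U`.
    obtain ⟨l, -, hl⟩ := (isCompact_Icc (a := -(C * ‖y‖)) (b := C * ‖y‖)).ultrafilter_le_nhds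
      (U.map fun n => inner ℝ (z n) y)
      (by
        rw [le_principal_iff]
        exact mem_map.2 (univ_mem' fun n => abs_le.1 (hb y n)))
    exact ⟨l, hl⟩
  choose l hl using key
  -- The limits form a bounded linear functional of `y`, which the Riesz theorem represents by a
  -- vector.
  let L : M →ₗ[ℝ] ℝ :=
    { toFun := l
      map_add' := fun a b => tendsto_nhds_unique (hl (a + b))
        (by simpa only [inner_add_right] using (hl a).add (hl b))
      map_smul' := fun c a => tendsto_nhds_unique (hl (c • a))
        (by simpa only [inner_smul_right, smul_eq_mul, RingHom.id_apply] using (hl a).const_mul c) }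
  have hL : ∀ y, ‖L y‖ ≤ C * ‖y‖ := fun y =>
    le_of_tendsto (hl y).norm (Eventually.of_forall fun n => hb y n)
  refine ⟨(InnerProductSpace.toDual ℝ M).symm (L.mkContinuous C hL), fun y => ?_⟩
  rw [InnerProductSpace.toDual_symm_apply]
  exact hl y

end Weak

section GraphClosed

variable {H K : Type*} [NormedAddCommGroup H] [InnerProductSpace ℝ H] [CompleteSpace H]
  [NormedAddCommGroup K] [InnerProductSpace ℝ K] [CompleteSpace K]

/-- Lower semicontinuity of `‖g‖` on a closed linear relation `Γ ⊆ H × K`. -/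
theorem exists_mem_of_bounded {Γ : Submodule ℝ (H × K)} (hΓ : IsClosed (Γ : Set (H × K)))
    {z : ℕ → H × K} (hz : ∀ n, z n ∈ Γ) {u : H} (hu : Tendsto (fun n => (z n).1) atTop (𝓝 u))
    {c : ℕ → ℝ} {c₀ : ℝ} (hc : ∀ n, ‖(z n).2‖ ≤ c n) (hc₀ : Tendsto c atTop (𝓝 c₀)) :
    ∃ g, (u, g) ∈ Γ ∧ ‖g‖ ≤ c₀ := by
  -- The sup norm on `H × K` is not Hilbertian; the equivalent `ℓ²` norm makes weak limits
  -- available.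
  let e : WithLp 2 (H × K) ≃L[ℝ] H × K := WithLp.prodContinuousLinearEquiv 2 ℝ H K
  let Γ' : Submodule ℝ (WithLp 2 (H × K)) := Γ.comap (e : WithLp 2 (H × K) →ₗ[ℝ] H × K)
  have hΓ' : IsClosed (Γ' : Set (WithLp 2 (H × K))) := hΓ.preimage e.continuous
  have : CompleteSpace Γ' := hΓ'.completeSpace_coe
  let w : ℕ → WithLp 2 (H × K) := fun n => WithLp.toLp 2 (z n)
  have hw : ∀ n, w n ∈ Γ' := fun n => hz n
  obtain ⟨R, hR⟩ := Metric.isBounded_range_of_tendsto _ hu |>.exists_norm_le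
  obtain ⟨R', hR'⟩ := Metric.isBounded_range_of_tendsto _ hc₀ |>.exists_norm_le
  have hb : ∀ n, ‖w n‖ ≤ R + R' := by
    intro n
    have h1 : ‖(z n).1‖ ≤ R := hR _ ⟨n, rfl⟩
    have h2 : ‖(z n).2‖ ≤ R' := (hc n).trans ((le_abs_self _).trans (hR' _ ⟨n, rfl⟩))
    have h3 := norm_nonneg (z n).1
    have h4 := norm_nonneg (z n).2
    have h5 : ‖w n‖ ^ 2 = ‖(z n).1‖ ^ 2 + ‖(z n).2‖ ^ 2 := WithLp.prod_norm_sq_eq_of_L2 _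
    refine le_of_sq_le_sq ?_ (by linarith)
    rw [h5]
    nlinarith
  let U : Ultrafilter ℕ := Ultrafilter.of atTop
  have hU : (U : Filter ℕ) ≤ atTop := Ultrafilter.of_le atTop
  obtain ⟨v, hv⟩ := exists_weak_limit U w (R + R') hb
  -- A closed subspace is its own double orthogonal complement, hence weakly closed.
  have hvΓ : v ∈ Γ' := by
    rw [← Γ'.orthogonal_orthogonal, Submodule.mem_orthogonal]
    intro y hy
    have : Tendsto (fun n => inner ℝ (w n) y) U (𝓝 0) := by
      refine tendsto_const_nhds.congr fun n => ?_
      exact ((Submodule.mem_orthogonal _ _).1 hy _ (hw n)).symm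
    rw [real_inner_comm]
    exact tendsto_nhds_unique (hv y) this
  have hv1 : v.fst = u := by
    refine ext_inner_right ℝ fun a => ?_
    have h := hv (WithLp.toLp 2 (a, 0))
    simp only [WithLp.prod_inner_apply, inner_zero_right, add_zero] at h
    exact tendsto_nhds_unique h ((hu.mono_left hU).inner tendsto_const_nhds)
  refine ⟨v.snd, ?_, ?_⟩
  · rw [← hv1]; exact hvΓ
  -- Testing the weak limit against its own second component gives `‖g‖² ≤ c₀ ‖g‖`.
  · have h := hv (WithLp.toLp 2 (0, v.snd))
    simp only [WithLp.prod_inner_apply, inner_zero_right, zero_add] at h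
    have h2 : inner ℝ v.snd v.snd ≤ c₀ * ‖v.snd‖ :=
      le_of_tendsto_of_tendsto' h ((hc₀.mono_left hU).mul_const _) fun n =>
        (real_inner_le_norm _ _).trans (by gcongr; exact hc n)
    rw [real_inner_self_eq_norm_mul_norm] at h2
    rcases (norm_nonneg v.snd).eq_or_lt with h0 | h0
    · rw [← h0]; exact ge_of_tendsto' hc₀ fun n => (norm_nonneg _).trans (hc n)
    · exact le_of_mul_le_mul_right h2 h0

end GraphClosed

/-- The linear relation `Γ` is the graph of an operator. -/
def IsFunctional {H K : Type*} [AddCommGroup H] [Module ℝ H] [AddCommGroup K] [Module ℝ K]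
    (Γ : Submodule ℝ (H × K)) : Prop :=
  ∀ x ∈ Γ, x.1 = 0 → x.2 = 0

namespace L2Form

section Graph

variable {X : Type*} [MeasurableSpace X] {μ : Measure X}
  {K : Type*} [NormedAddCommGroup K] [InnerProductSpace ℝ K]

/-- The form `(u, v) ↦ ⟪A u, A v⟫` of the operator `A` with graph `Γ`. -/
def ofGraph (Γ : Submodule ℝ (Lp ℝ 2 μ × K)) : L2Form μ where
  domain := Γ.toLinearPMap.domain
  -- If `Γ` is not functional, `toLinearPMap` takes the value zero throughout its domain; results
  -- identifying `op` therefore assume `IsFunctional`.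
  form := (innerₗ K).compl₁₂ Γ.toLinearPMap.toFun Γ.toLinearPMap.toFun

/-- The operator with graph `Γ`. -/
def op (Γ : Submodule ℝ (Lp ℝ 2 μ × K)) : (ofGraph Γ).domain →ₗ[ℝ] K := Γ.toLinearPMap.toFun

variable {Γ Γ₀ : Submodule ℝ (Lp ℝ 2 μ × K)}

theorem ofGraph_form (u v : (ofGraph Γ).domain) :
    (ofGraph Γ).form u v = inner ℝ (op Γ u) (op Γ v) := rfl

theorem ofGraph_form_self (u : (ofGraph Γ).domain) :
    (ofGraph Γ).form u u = ‖op Γ u‖ ^ 2 := real_inner_self_eq_norm_sq _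

theorem mem_ofGraph_domain {u : Lp ℝ 2 μ} : u ∈ (ofGraph Γ).domain ↔ ∃ g, (u, g) ∈ Γ := by
  change u ∈ Γ.map (LinearMap.fst ℝ _ _) ↔ _
  simp

theorem mem_graph (hΓ : IsFunctional Γ) (u : (ofGraph Γ).domain) :
    ((u : Lp ℝ 2 μ), op Γ u) ∈ Γ :=
  Submodule.mem_graph_toLinearPMap hΓ u

theorem op_eq (hΓ : IsFunctional Γ) {u : (ofGraph Γ).domain} {g : K}
    (h : ((u : Lp ℝ 2 μ), g) ∈ Γ) : op Γ u = g := by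
  have h1 := hΓ _ (Γ.sub_mem (mem_graph hΓ u) h) (by simp)
  exact sub_eq_zero.1 h1

theorem ofGraph_isSymm : (ofGraph Γ).IsSymm := fun _ _ => real_inner_comm _ _

theorem ofGraph_isPositive : (ofGraph Γ).IsPositive := fun _ => real_inner_self_nonneg

theorem cauchySeq_of_tendsto_sq {E : Type*} [NormedAddCommGroup E] {f : ℕ → E}
    (h : Tendsto (fun p : ℕ × ℕ => ‖f p.1 - f p.2‖ ^ 2) atTop (𝓝 0)) : CauchySeq f := by
  rw [cauchySeq_iff_tendsto_dist_atTop_0]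
  have := h.sqrt
  simpa [Real.sqrt_sq, dist_eq_norm] using this

/-- `energyOne` is the squared `ℓ²` norm of the pair `(u, op Γ u)`, so completeness of the domain is
completeness of the closed set `Γ`. -/
theorem ofGraph_isClosedForm [CompleteSpace K] (hΓ : IsFunctional Γ)
    (hcl : IsClosed (Γ : Set (Lp ℝ 2 μ × K))) : (ofGraph Γ).IsClosedForm := by
  intro u hu
  have e1 : ∀ p : ℕ × ℕ, (ofGraph Γ).energyOne (u p.1 - u p.2) =
      ‖op Γ (u p.1) - op Γ (u p.2)‖ ^ 2 +
        ‖(u p.1 : Lp ℝ 2 μ) - u p.2‖ ^ 2 := fun p => by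
    rw [energyOne, ofGraph_form_self, map_sub]; rfl
  simp only [e1] at hu
  have c1 : CauchySeq fun k => op Γ (u k) :=
    cauchySeq_of_tendsto_sq (squeeze_zero (fun _ => by positivity)
      (fun p => le_add_of_nonneg_right (by positivity)) hu)
  have c2 : CauchySeq fun k => (u k : Lp ℝ 2 μ) :=
    cauchySeq_of_tendsto_sq (squeeze_zero (fun _ => by positivity)
      (fun p => le_add_of_nonneg_left (by positivity)) hu)
  obtain ⟨g, hg⟩ := cauchySeq_tendsto_of_complete c1
  obtain ⟨v, hv⟩ := cauchySeq_tendsto_of_complete c2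
  have hmem : (v, g) ∈ Γ :=
    hcl.mem_of_tendsto (hv.prodMk_nhds hg) (Eventually.of_forall fun k => mem_graph hΓ (u k))
  refine ⟨⟨v, mem_ofGraph_domain.2 ⟨g, hmem⟩⟩, ?_⟩
  have e2 : ∀ k, (ofGraph Γ).energyOne (u k - ⟨v, mem_ofGraph_domain.2 ⟨g, hmem⟩⟩) =
      ‖op Γ (u k) - g‖ ^ 2 + ‖(u k : Lp ℝ 2 μ) - v‖ ^ 2 := fun k => by
    rw [energyOne, ofGraph_form_self, map_sub]
    rw [op_eq hΓ (u := ⟨v, mem_ofGraph_domain.2 ⟨g, hmem⟩⟩) hmem]; rfl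
  simp only [e2]
  have h1 := ((hg.sub_const g).norm.pow 2).add ((hv.sub_const v).norm.pow 2)
  simpa using h1

theorem IsFunctional.mono (hΓ : IsFunctional Γ) (h : Γ₀ ≤ Γ) : IsFunctional Γ₀ :=
  fun x hx => hΓ x (h hx)

/-- The pairs `(u k, op Γ₀ (u k))` converge to some `(0, g)` in the closed graph, and functionality
forces `g = 0`. -/
theorem ofGraph_isClosable [CompleteSpace K] (hΓ : IsFunctional Γ₀.topologicalClosure) :
    (ofGraph Γ₀).IsClosable := by
  have hΓ₀ : IsFunctional Γ₀ := IsFunctional.mono hΓ Γ₀.le_topologicalClosure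
  intro u hu h0
  have e1 : ∀ p : ℕ × ℕ, (ofGraph Γ₀).form (u p.1 - u p.2) (u p.1 - u p.2) =
      ‖op Γ₀ (u p.1) - op Γ₀ (u p.2)‖ ^ 2 := fun p => by
    rw [ofGraph_form_self, map_sub]
  simp only [IsCauchy, e1] at hu
  have c1 : CauchySeq fun k => op Γ₀ (u k) := cauchySeq_of_tendsto_sq hu
  obtain ⟨g, hg⟩ := cauchySeq_tendsto_of_complete c1
  have hmem : ((0 : Lp ℝ 2 μ), g) ∈ Γ₀.topologicalClosure :=
    Γ₀.isClosed_topologicalClosure.mem_of_tendsto (h0.prodMk_nhds hg)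
      (Eventually.of_forall fun k => Γ₀.le_topologicalClosure (mem_graph hΓ₀ (u k)))
  have g0 : g = 0 := hΓ ((0 : Lp ℝ 2 μ), g) hmem (by dsimp only)
  simp only [ofGraph_form_self]
  have h1 := hg.norm.pow 2
  rwa [g0, norm_zero, zero_pow two_ne_zero] at h1

/-- Density for `energyOne` is density of `Γ₀` in its closure, read in the graph norm. -/
theorem ofGraph_isClosureOf [CompleteSpace K] (hΓ : IsFunctional Γ₀.topologicalClosure) :
    (ofGraph Γ₀.topologicalClosure).IsClosureOf (ofGraph Γ₀) := by
  have hΓ₀ : IsFunctional Γ₀ := IsFunctional.mono hΓ Γ₀.le_topologicalClosure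
  have hle : (ofGraph Γ₀).domain ≤ (ofGraph Γ₀.topologicalClosure).domain := by
    intro u hu
    obtain ⟨g, hg⟩ := mem_ofGraph_domain.1 hu
    exact mem_ofGraph_domain.2 ⟨g, Γ₀.le_topologicalClosure hg⟩
  have heq : ∀ u : (ofGraph Γ₀).domain,
      op Γ₀.topologicalClosure (Submodule.inclusion hle u) = op Γ₀ u :=
    fun u => op_eq hΓ (u := Submodule.inclusion hle u)
      (Γ₀.le_topologicalClosure (mem_graph hΓ₀ u))
  refine ⟨hle, fun u v => ?_, ofGraph_isClosedForm hΓ Γ₀.isClosed_topologicalClosure, fun u => ?_⟩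
  · rw [ofGraph_form, ofGraph_form, heq, heq]
  · have hm : ((u : Lp ℝ 2 μ), op Γ₀.topologicalClosure u) ∈
        closure (Γ₀ : Set (Lp ℝ 2 μ × K)) := mem_graph hΓ u
    obtain ⟨z, hz, hzt⟩ := mem_closure_iff_seq_limit.1 hm
    refine ⟨fun k => ⟨(z k).1, mem_ofGraph_domain.2 ⟨(z k).2, hz k⟩⟩, ?_⟩
    have e2 : ∀ k, (ofGraph Γ₀.topologicalClosure).energyOne (u - Submodule.inclusion hle
        ⟨(z k).1, mem_ofGraph_domain.2 ⟨(z k).2, hz k⟩⟩) =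
        ‖op Γ₀.topologicalClosure u - (z k).2‖ ^ 2 +
          ‖(u : Lp ℝ 2 μ) - (z k).1‖ ^ 2 := fun k => by
      rw [energyOne, ofGraph_form_self, map_sub, heq,
        op_eq hΓ₀ (u := ⟨(z k).1, mem_ofGraph_domain.2 ⟨(z k).2, hz k⟩⟩) (hz k)]
      rfl
    simp only [e2]
    have t1 := (continuous_fst.tendsto _).comp hzt
    have t2 := (continuous_snd.tendsto _).comp hzt
    have h1 := ((t2.const_sub (op Γ₀.topologicalClosure u)).norm.pow 2).add
      ((t1.const_sub (u : Lp ℝ 2 μ)).norm.pow 2)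
    simpa using h1

/-- An element of zero energy is invariant under the semigroup of the form. -/
theorem IsSemigroupOf.apply_eq_self {𝓔 : L2Form μ} {T : ℝ → (Lp ℝ 2 μ →L[ℝ] Lp ℝ 2 μ)}
    (hT : 𝓔.IsSemigroupOf T) (e : 𝓔.domain) (he : 𝓔.form e e = 0) (t : ℝ) (ht : 0 ≤ t) :
    T t (e : Lp ℝ 2 μ) = e := by
  set f : Lp ℝ 2 μ := (e : Lp ℝ 2 μ) with hf
  let q : ℝ → ℝ := fun t => inner ℝ (f - T t f) f
  have S := hT.semigroup
  -- The difference `2 q(r) - q(2r)` equals `‖f - T r f‖²`.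
  have hq2 : ∀ r, 0 ≤ r → q (2 * r) ≤ 2 * q r := by
    intro r hr
    have h1 : T (2 * r) f = T r (T r f) := by rw [two_mul, S.add r r hr hr]
    have h2 : inner ℝ (T r (T r f)) f = inner ℝ (T r f) (T r f) := S.symm r hr _ _
    have h3 : (0 : ℝ) ≤ inner ℝ (f - T r f) (f - T r f) := real_inner_self_nonneg
    simp only [q, h1, inner_sub_left, inner_sub_right, h2] at h3 ⊢
    have h4 : inner ℝ f (T r f) = inner ℝ (T r f) f := real_inner_comm _ _
    linarith
  have hqn : ∀ n : ℕ, q t ≤ 2 ^ n * q (t / 2 ^ n) := by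
    intro n
    induction n with
    | zero => simp
    | succ n ih =>
      refine ih.trans ?_
      have h := hq2 (t / 2 ^ (n + 1)) (by positivity)
      have h' : 2 * (t / 2 ^ (n + 1)) = t / 2 ^ n := by field_simp; ring
      rw [h'] at h
      calc (2 : ℝ) ^ n * q (t / 2 ^ n) ≤ 2 ^ n * (2 * q (t / 2 ^ (n + 1))) := by gcongr
        _ = _ := by ring
  -- By repeated halving, `q(t) / t` is at most `q(t / 2ⁿ) / (t / 2ⁿ)`, which tends to the energy
  -- `0`.
  have hle : q t ≤ 0 := by
    rcases ht.eq_or_lt with rfl | ht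
    · simp [q, S.zero]
    have hlim := hT.form_eq e e
    rw [he] at hlim
    have hseq : Tendsto (fun n : ℕ => t / 2 ^ n) atTop (𝓝[>] 0) := by
      refine tendsto_nhdsWithin_iff.2 ⟨?_, Eventually.of_forall fun n => ?_⟩
      · exact tendsto_const_nhds.div_atTop (tendsto_pow_atTop_atTop_of_one_lt one_lt_two)
      · exact mem_Ioi.2 (by positivity)
    have h2 := (hlim.comp hseq).const_mul t
    rw [mul_zero] at h2
    refine ge_of_tendsto' h2 fun n => (hqn n).trans (le_of_eq ?_)
    simp only [Function.comp, q, ← hf]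
    field_simp
  -- Contractivity gives `‖f - T t f‖² ≤ 2 q(t)`.
  have h5 : ‖f - T t f‖ ^ 2 ≤ 0 := by
    have h6 := S.contraction t ht f
    have h7 : ‖f - T t f‖ ^ 2 = ‖f‖ ^ 2 - 2 * inner ℝ f (T t f) + ‖T t f‖ ^ 2 :=
      norm_sub_sq_real _ _
    have h8 : q t = ‖f‖ ^ 2 - inner ℝ f (T t f) := by
      rw [real_inner_comm, ← real_inner_self_eq_norm_sq, ← inner_sub_left]
    nlinarith [norm_nonneg (T t f), norm_nonneg f]
  have h6 : f - T t f = 0 := by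
    rw [← norm_eq_zero]
    exact pow_eq_zero_iff two_ne_zero |>.1 (le_antisymm h5 (by positivity))
  exact (sub_eq_zero.1 h6).symm

end Graph

end L2Form

/-! ### Calculus on the orthant -/

section OrthantCalculus

variable {ι : Type*}

/-- The inclusion `[0, ∞)^ι ⊆ ℝ^ι`. -/
def emb (φ : ι → ℝ≥0) : ι → ℝ := fun x => (φ x : ℝ)

/-- The retraction of `ℝ^ι` onto `[0, ∞)^ι`. -/
def retr (u : ι → ℝ) : ι → ℝ≥0 := fun x => (u x).toNNReal

theorem retr_emb (φ : ι → ℝ≥0) : retr (emb φ) = φ := by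
  funext x; simp [retr, emb]

theorem lift_emb (F : (ι → ℝ≥0) → ℝ) (φ : ι → ℝ≥0) : lift F (emb φ) = F φ :=
  congrArg F (retr_emb φ)

theorem emb_retr {u : ι → ℝ} (hu : ∀ x, 0 < u x) : emb (retr u) = u := by
  funext x; simp [retr, emb, (hu x).le]

theorem continuous_emb : Continuous (emb : (ι → ℝ≥0) → ι → ℝ) := by
  unfold emb; fun_prop

theorem continuous_retr : Continuous (retr : (ι → ℝ) → ι → ℝ≥0) := by
  unfold retr; fun_prop

theorem isClosedEmbedding_emb : IsClosedEmbedding (emb : (ι → ℝ≥0) → ι → ℝ) :=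
  (show Function.LeftInverse retr emb from retr_emb).isClosedEmbedding continuous_retr
    continuous_emb

/-- Identities for extended derivatives are proved in the open orthant and reach the faces by
continuity. -/
theorem dense_openOrthant : Dense (openOrthant ι) := by
  have h : openOrthant ι = Set.pi univ fun _ => Ioi (0 : ℝ≥0) := by
    ext φ; simp [openOrthant]
  rw [h]
  refine dense_pi _ fun x _ => ?_
  rw [dense_iff_closure_eq, closure_Ioi]
  ext; simp

theorem emb_pos {φ : ι → ℝ≥0} (hφ : φ ∈ openOrthant ι) (x : ι) : 0 < emb φ x :=
  NNReal.coe_pos.2 (hφ x)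

theorem isOpen_posOrthant [Finite ι] : IsOpen {u : ι → ℝ | ∀ x, 0 < u x} := by
  simp only [ofPred_forall]
  exact isOpen_iInter_of_finite fun x => isOpen_lt continuous_const (continuous_apply x)

variable [DecidableEq ι]

theorem emb_update (φ : ι → ℝ≥0) (x : ι) {t : ℝ} (ht : 0 ≤ t) :
    emb (Function.update φ x t.toNNReal) = Function.update (emb φ) x t := by
  funext y
  rcases eq_or_ne y x with rfl | h
  · simp [emb, ht]
  · simp [emb, h]

theorem pderiv_eq {F g : (ι → ℝ≥0) → ℝ} {x : ι} (hg : Continuous g)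
    (h : ∀ φ ∈ openOrthant ι, g φ = fderiv ℝ (lift F) (emb φ) (Pi.single x 1)) :
    pderiv x F = g := by
  funext φ
  refine extendFrom_eq (dense_openOrthant φ) ?_
  refine (hg.continuousAt.mono_left nhdsWithin_le_nhds : Tendsto g (𝓝[openOrthant ι] φ) _).congr'
    ?_
  filter_upwards [self_mem_nhdsWithin] with ψ hψ using h ψ hψ

theorem continuous_update_toNNReal (φ : ι → ℝ≥0) (x : ι) :
    Continuous fun t : ℝ => Function.update φ x t.toNNReal := by
  fun_prop

variable [Fintype ι]

namespace IsCc

variable {F G : (ι → ℝ≥0) → ℝ}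

theorem contDiffAt (hF : IsCc 2 F) {u : ι → ℝ} (hu : ∀ x, 0 < u x) : ContDiffAt ℝ 2 (lift F) u :=
  hF.contDiffOn.contDiffAt (isOpen_posOrthant.mem_nhds hu)

theorem contDiffAt_emb (hF : IsCc 2 F) {φ : ι → ℝ≥0} (hφ : φ ∈ openOrthant ι) :
    ContDiffAt ℝ 2 (lift F) (emb φ) :=
  hF.contDiffAt (emb_pos hφ)

theorem pderiv_spec (hF : IsCc 2 F) (x : ι) : Continuous (pderiv x F) ∧
    ∀ φ ∈ openOrthant ι, pderiv x F φ = fderiv ℝ (lift F) (emb φ) (Pi.single x 1) := by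
  obtain ⟨g, hg, h⟩ := hF.extends_deriv 1 (by norm_num) fun _ => x
  have h' : ∀ φ ∈ openOrthant ι, g φ = fderiv ℝ (lift F) (emb φ) (Pi.single x 1) := fun φ hφ => by
    rw [h φ hφ, iteratedFDeriv_one_apply]; rfl
  rw [pderiv_eq hg h']
  exact ⟨hg, h'⟩

theorem continuous_pderiv (hF : IsCc 2 F) (x : ι) : Continuous (pderiv x F) :=
  (hF.pderiv_spec x).1

theorem pderiv_apply (hF : IsCc 2 F) (x : ι) {φ : ι → ℝ≥0} (hφ : φ ∈ openOrthant ι) :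
    pderiv x F φ = fderiv ℝ (lift F) (emb φ) (Pi.single x 1) :=
  (hF.pderiv_spec x).2 φ hφ

/-- A nonzero value off `tsupport F` would, by density, also occur at a point of the open orthant
off `tsupport F`, where `lift F` vanishes nearby. -/
theorem tsupport_pderiv_subset (hF : IsCc 2 F) (x : ι) : tsupport (pderiv x F) ⊆ tsupport F := by
  refine closure_minimal ?_ (isClosed_tsupport F)
  intro φ hφ
  by_contra hn
  have hU : IsOpen (tsupport F)ᶜ := (isClosed_tsupport F).isOpen_compl
  have hne : ({ψ | pderiv x F ψ ≠ 0} ∩ (tsupport F)ᶜ).Nonempty := ⟨φ, hφ, hn⟩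
  obtain ⟨ψ, ⟨hψ, hψ'⟩, hψO⟩ := dense_openOrthant.inter_open_nonempty _
    ((isOpen_ne_fun (hF.continuous_pderiv x) continuous_const).inter hU) hne
  refine hψ ?_
  rw [hF.pderiv_apply x hψO]
  have : lift F =ᶠ[𝓝 (emb ψ)] fun _ => 0 := by
    have h1 : retr ⁻¹' (tsupport F)ᶜ ∈ 𝓝 (emb ψ) :=
      (hU.preimage continuous_retr).mem_nhds (by rw [mem_preimage, retr_emb]; exact hψ')
    filter_upwards [h1] with u hu
    exact image_eq_zero_of_notMem_tsupport (f := F) hu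
  rw [this.fderiv_eq]
  simp

theorem hasCompactSupport_pderiv (hF : IsCc 2 F) (x : ι) : HasCompactSupport (pderiv x F) :=
  hF.compactSupport.of_isClosed_subset (isClosed_tsupport _) (hF.tsupport_pderiv_subset x)

theorem add (hF : IsCc 2 F) (hG : IsCc 2 G) : IsCc 2 (F + G) where
  continuous := hF.continuous.add hG.continuous
  compactSupport := hF.compactSupport.add hG.compactSupport
  contDiffOn := hF.contDiffOn.add hG.contDiffOn
  extends_deriv l hl v := by
    obtain ⟨f, hf, hf'⟩ := hF.extends_deriv l hl v
    obtain ⟨g, hg, hg'⟩ := hG.extends_deriv l hl v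
    refine ⟨f + g, hf.add hg, fun φ hφ => ?_⟩
    have hl' : (l : WithTop ℕ∞) ≤ 2 := mod_cast hl
    have h := iteratedFDeriv_add_apply (i := l) ((hF.contDiffAt_emb hφ).of_le hl')
      ((hG.contDiffAt_emb hφ).of_le hl')
    change f φ + g φ = iteratedFDeriv ℝ l (lift F + lift G) (emb φ) _
    rw [h, hf' φ hφ, hg' φ hφ]
    rfl

theorem const_smul (hF : IsCc 2 F) (c : ℝ) : IsCc 2 (c • F) where
  continuous := hF.continuous.const_smul c
  compactSupport := hF.compactSupport.smul_left (f := fun _ => c)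
  contDiffOn := contDiffOn_const.smul hF.contDiffOn
  extends_deriv l hl v := by
    obtain ⟨f, hf, hf'⟩ := hF.extends_deriv l hl v
    refine ⟨c • f, hf.const_smul c, fun φ hφ => ?_⟩
    have hl' : (l : WithTop ℕ∞) ≤ 2 := mod_cast hl
    have h := iteratedFDeriv_const_smul_apply (i := l) (a := c)
      ((hF.contDiffAt_emb hφ).of_le hl')
    change c • f φ = iteratedFDeriv ℝ l (c • lift F) (emb φ) _
    rw [h, hf' φ hφ]
    rfl

theorem zero : IsCc 2 (0 : (ι → ℝ≥0) → ℝ) where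
  continuous := continuous_const
  compactSupport := HasCompactSupport.zero
  contDiffOn := contDiffOn_const (c := (0 : ℝ))
  extends_deriv l _ v := by
    refine ⟨0, continuous_const, fun φ hφ => ?_⟩
    have h : lift (0 : (ι → ℝ≥0) → ℝ) = 0 := rfl
    rw [h, show (0 : (ι → ℝ) → ℝ) = fun _ => 0 from rfl, iteratedFDeriv_fun_zero]
    rfl

theorem pderiv_add (hF : IsCc 2 F) (hG : IsCc 2 G) (x : ι) :
    pderiv x (F + G) = pderiv x F + pderiv x G := by
  refine pderiv_eq ((hF.continuous_pderiv x).add (hG.continuous_pderiv x)) fun φ hφ => ?_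
  have h : lift (F + G) = lift F + lift G := rfl
  rw [h, fderiv_add ((hF.contDiffAt_emb hφ).differentiableAt two_ne_zero)
    ((hG.contDiffAt_emb hφ).differentiableAt two_ne_zero), Pi.add_apply, hF.pderiv_apply x hφ,
    hG.pderiv_apply x hφ]
  rfl

theorem pderiv_const_smul (hF : IsCc 2 F) (c : ℝ) (x : ι) :
    pderiv x (c • F) = c • pderiv x F := by
  refine pderiv_eq ((hF.continuous_pderiv x).const_smul c) fun φ hφ => ?_
  have h : lift (c • F) = c • lift F := rfl
  rw [h, fderiv_const_smul ((hF.contDiffAt_emb hφ).differentiableAt two_ne_zero), Pi.smul_apply,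
    hF.pderiv_apply x hφ]
  rfl

/-- The restriction to the orthant of a compactly supported `C²` function on `ℝ^ι`. -/
theorem of_contDiff {f : (ι → ℝ) → ℝ} (hf : ContDiff ℝ 2 f) (hc : HasCompactSupport f) :
    IsCc 2 (fun φ => f (emb φ)) where
  continuous := hf.continuous.comp continuous_emb
  compactSupport := hc.comp_isClosedEmbedding isClosedEmbedding_emb
  contDiffOn := by
    refine hf.contDiffOn.congr fun u hu => ?_
    exact congrArg f (emb_retr hu)
  extends_deriv l hl v := by
    have hl' : (l : WithTop ℕ∞) ≤ 2 := mod_cast hl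
    refine ⟨fun φ => iteratedFDeriv ℝ l f (emb φ) fun j => Pi.single (v j) 1, ?_, fun φ hφ => ?_⟩
    · have := (hf.continuous_iteratedFDeriv hl').comp continuous_emb
      exact (ContinuousMultilinearMap.apply ℝ (fun _ : Fin l => ι → ℝ) ℝ _).continuous.comp this
    · have h : lift (fun φ => f (emb φ)) =ᶠ[𝓝 (emb φ)] f := by
        filter_upwards [isOpen_posOrthant.mem_nhds
          (show emb φ ∈ {u : ι → ℝ | ∀ x, 0 < u x} from emb_pos hφ)] with u hu
        exact congrArg f (emb_retr hu)
      exact congrArg (fun T => T fun j => Pi.single (v j) 1) (h.iteratedFDeriv ℝ l).eq_of_nhds.symm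

theorem pderiv_of_contDiff {f : (ι → ℝ) → ℝ} (hf : ContDiff ℝ 2 f) (x : ι) :
    pderiv x (fun φ => f (emb φ)) = fun φ => fderiv ℝ f (emb φ) (Pi.single x 1) := by
  refine pderiv_eq ?_ fun φ hφ => ?_
  · exact ((hf.continuous_fderiv two_ne_zero).comp continuous_emb).clm_apply continuous_const
  · have h : lift (fun φ => f (emb φ)) =ᶠ[𝓝 (emb φ)] f := by
      filter_upwards [isOpen_posOrthant.mem_nhds
        (show emb φ ∈ {u : ι → ℝ | ∀ x, 0 < u x} from emb_pos hφ)] with u hu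
      exact congrArg f (emb_retr hu)
    rw [h.fderiv_eq]

theorem fderiv_comp_lift (hF : IsCc 2 F) {j : ℝ → ℝ} (hj : ContDiff ℝ 2 j) {u : ι → ℝ}
    (hu : ∀ x, 0 < u x) : fderiv ℝ (lift (j ∘ F)) u = deriv j (lift F u) • fderiv ℝ (lift F) u := by
  have h1 := ((hF.contDiffAt hu).differentiableAt two_ne_zero).hasFDerivAt
  have h2 := ((hj.differentiable two_ne_zero) (lift F u)).hasDerivAt
  exact (h2.comp_hasFDerivAt u h1).fderiv

/-- The chain rule writes the derivatives up to order two through `j'`, `j''` and derivatives of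
`F`, all of which extend continuously. The condition `j 0 = 0` preserves compact support. -/
theorem comp_left (hF : IsCc 2 F) {j : ℝ → ℝ} (hj : ContDiff ℝ 2 j) (h0 : j 0 = 0) :
    IsCc 2 (j ∘ F) where
  continuous := hj.continuous.comp hF.continuous
  compactSupport := hF.compactSupport.comp_left h0
  contDiffOn := hj.comp_contDiffOn hF.contDiffOn
  extends_deriv l hl v := by
    have hj1 : ContDiff ℝ 1 (deriv j) := by
      have : ContDiff ℝ (1 + 1) j := by simpa [one_add_one_eq_two] using hj
      exact (contDiff_succ_iff_deriv.1 this).2.2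
    have hj2 : Continuous (deriv (deriv j)) := hj1.continuous_deriv le_rfl
    interval_cases l
    · refine ⟨j ∘ F, hj.continuous.comp hF.continuous, fun φ hφ => ?_⟩
      rw [iteratedFDeriv_zero_apply]
      exact (lift_emb (j ∘ F) φ).symm
    · refine ⟨fun φ => deriv j (F φ) * pderiv (v 0) F φ,
        (hj1.continuous.comp hF.continuous).mul (hF.continuous_pderiv _), fun φ hφ => ?_⟩
      rw [iteratedFDeriv_one_apply]
      change deriv j (F φ) * pderiv (v 0) F φ = fderiv ℝ (lift (j ∘ F)) (emb φ) _
      rw [hF.fderiv_comp_lift hj (emb_pos hφ), hF.pderiv_apply _ hφ, lift_emb]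
      rfl
    · obtain ⟨g, hg, hg'⟩ := hF.extends_deriv 2 le_rfl v
      refine ⟨fun φ => deriv j (F φ) * g φ + deriv (deriv j) (F φ) * pderiv (v 0) F φ *
        pderiv (v 1) F φ, ?_, fun φ hφ => ?_⟩
      · have c1 := hj1.continuous.comp hF.continuous
        have c2 := hj2.comp hF.continuous
        exact (c1.mul hg).add ((c2.mul (hF.continuous_pderiv _)).mul (hF.continuous_pderiv _))
      · have hpos := emb_pos hφ
        beta_reduce
        rw [hg' φ hφ, iteratedFDeriv_two_apply, iteratedFDeriv_two_apply, hF.pderiv_apply _ hφ,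
          hF.pderiv_apply _ hφ]
        change _ = fderiv ℝ (fderiv ℝ (lift (j ∘ F))) (emb φ) _ _
        -- The first-order formula holds on a neighbourhood, so it can be differentiated again.
        have hev : fderiv ℝ (lift (j ∘ F)) =ᶠ[𝓝 (emb φ)]
            fun u => deriv j (lift F u) • fderiv ℝ (lift F) u := by
          filter_upwards [isOpen_posOrthant.mem_nhds
            (show emb φ ∈ {u : ι → ℝ | ∀ x, 0 < u x} from hpos)] with u hu
          exact hF.fderiv_comp_lift hj hu
        have d1 := ((hF.contDiffAt hpos).differentiableAt two_ne_zero).hasFDerivAt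
        have d2 := ((hj1.differentiable one_ne_zero) (lift F (emb φ))).hasDerivAt
        have d3 : HasFDerivAt (fderiv ℝ (lift F)) (fderiv ℝ (fderiv ℝ (lift F)) (emb φ)) (emb φ) :=
          (((hF.contDiffAt hpos).fderiv_right (m := 1)
            (by simp [one_add_one_eq_two])).differentiableAt one_ne_zero).hasFDerivAt
        have d4 := (d2.comp_hasFDerivAt _ d1).smul d3
        rw [hev.fderiv_eq]
        erw [d4.fderiv]
        simp only [Function.comp, lift_emb, _root_.add_apply,
          _root_.smul_apply, ContinuousLinearMap.smulRight_apply, smul_eq_mul]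
        rfl

theorem pderiv_comp_left (hF : IsCc 2 F) {j : ℝ → ℝ} (hj : ContDiff ℝ 2 j) (x : ι) :
    pderiv x (j ∘ F) = fun φ => deriv j (F φ) * pderiv x F φ := by
  refine pderiv_eq (((hj.continuous_deriv (by norm_num)).comp hF.continuous).mul
    (hF.continuous_pderiv x)) fun φ hφ => ?_
  rw [hF.fderiv_comp_lift hj (emb_pos hφ), hF.pderiv_apply _ hφ, lift_emb]
  rfl

/-- The fundamental theorem of calculus along a coordinate line, including on the faces of the
orthant. -/
theorem integral_pderiv (hF : IsCc 2 F) (x : ι) {a b : ℝ} (ha : 0 < a) (hb : 0 < b)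
    (φ : ι → ℝ≥0) : ∫ t in a..b, pderiv x F (Function.update φ x t.toNNReal) =
      F (Function.update φ x b.toNNReal) - F (Function.update φ x a.toNNReal) := by
  -- Both sides are continuous in `φ`, so it suffices to treat `φ` in the dense open orthant, where
  -- the whole segment is interior.
  have hcl : IsClosed {φ : ι → ℝ≥0 | ∫ t in a..b, pderiv x F (Function.update φ x t.toNNReal) =
      F (Function.update φ x b.toNNReal) - F (Function.update φ x a.toNNReal)} := by
    refine isClosed_eq ?_ ?_
    · refine intervalIntegral.continuous_parametric_intervalIntegral_of_continuous' ?_ a b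
      have := hF.continuous_pderiv x
      fun_prop
    · have := hF.continuous
      fun_prop
  refine closure_minimal ?_ hcl (dense_openOrthant φ)
  intro φ hφ
  have hupd : ∀ t : ℝ, 0 < t → Function.update φ x t.toNNReal ∈ openOrthant ι := by
    intro t ht y
    rcases eq_or_ne y x with rfl | h
    · simpa using ht
    · simpa [h] using hφ y
  refine intervalIntegral.integral_eq_sub_of_hasDerivAt
    (f := fun t => F (Function.update φ x t.toNNReal)) (fun t ht => ?_) ?_
  · have ht0 : 0 < t := (lt_min ha hb).trans_le ht.1
    have hev : (fun t : ℝ => F (Function.update φ x t.toNNReal)) =ᶠ[𝓝 t]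
        fun t => lift F (Function.update (emb φ) x t) := by
      filter_upwards [lt_mem_nhds ht0] with r hr
      rw [← emb_update φ x hr.le, lift_emb]
    refine HasDerivAt.congr_of_eventuallyEq ?_ hev
    rw [hF.pderiv_apply x (hupd t ht0)]
    have h1 := ((hF.contDiffAt_emb (hupd t ht0)).differentiableAt two_ne_zero).hasFDerivAt
    have h2 := hasDerivAt_update (𝕜 := ℝ) (emb φ) x t
    rw [emb_update φ x ht0.le] at h1 ⊢
    exact h1.comp_hasDerivAt t h2
  · exact ((hF.continuous_pderiv x).comp (continuous_update_toNNReal φ x)).intervalIntegrable _ _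

/-- When other coordinates of `φ` vanish, differentiability of `lift F` is not given; it is
recovered from the integral identity and the continuity of `pderiv x F`. -/
theorem hasDerivAt (hF : IsCc 2 F) (x : ι) (φ : ι → ℝ≥0) {t : ℝ} (ht : 0 < t) :
    HasDerivAt (fun t : ℝ => F (Function.update φ x t.toNNReal))
      (pderiv x F (Function.update φ x t.toNNReal)) t := by
  have hc := (hF.continuous_pderiv x).comp (continuous_update_toNNReal φ x)
  have h1 := intervalIntegral.integral_hasDerivAt_right (hc.intervalIntegrable t t)
    (hc.stronglyMeasurableAtFilter _ _) hc.continuousAt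
  refine (h1.const_add (F (Function.update φ x t.toNNReal))).congr_of_eventuallyEq ?_
  filter_upwards [lt_mem_nhds ht] with r hr
  have := hF.integral_pderiv x ht hr φ
  simp only [Function.comp]
  rw [this]
  ring

end IsCc

end OrthantCalculus

/-! ### The reference measure -/

section Reference

theorem isClosedEmbedding_coe : IsClosedEmbedding ((↑) : ℝ≥0 → ℝ) :=
  (isClosed_Ici (a := (0 : ℝ))).isClosedEmbedding_subtypeVal

theorem measurableEmbedding_coe : MeasurableEmbedding ((↑) : ℝ≥0 → ℝ) :=
  isClosedEmbedding_coe.measurableEmbedding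

instance : IsFiniteMeasureOnCompacts halfLineLebesgue :=
  IsFiniteMeasureOnCompacts.comap' _ NNReal.continuous_coe measurableEmbedding_coe

theorem map_halfLineLebesgue :
    halfLineLebesgue.map ((↑) : ℝ≥0 → ℝ) = volume.restrict (Ici 0) := by
  rw [halfLineLebesgue, measurableEmbedding_coe.map_comap]
  congr 1
  exact Subtype.range_coe

instance : halfLineLebesgue.IsOpenPosMeasure where
  open_pos U hU hne := by
    have h1 : (Ioi (0 : ℝ≥0) ∩ U).Nonempty := by
      have hd : Dense (Ioi (0 : ℝ≥0)) := by
        rw [dense_iff_closure_eq, closure_Ioi]; ext; simp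
      obtain ⟨y, hy, hy'⟩ := hd.inter_open_nonempty U hU hne
      exact ⟨y, hy', hy⟩
    have h2 : IsOpen (Ioi (0 : ℝ) ∩ Real.toNNReal ⁻¹' U) :=
      isOpen_Ioi.inter (hU.preimage continuous_real_toNNReal)
    have h3 : (Ioi (0 : ℝ) ∩ Real.toNNReal ⁻¹' U).Nonempty := by
      obtain ⟨y, hy, hyU⟩ := h1
      exact ⟨y, NNReal.coe_pos.2 hy, by simpa using hyU⟩
    have h4 : Ioi (0 : ℝ) ∩ Real.toNNReal ⁻¹' U ⊆ ((↑) : ℝ≥0 → ℝ) '' U := by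
      rintro t ⟨ht, htU⟩
      exact ⟨t.toNNReal, htU, Real.coe_toNNReal t (mem_Ioi.1 ht).le⟩
    rw [halfLineLebesgue, measurableEmbedding_coe.comap_apply]
    exact ((h2.measure_pos volume h3).trans_le (measure_mono h4)).ne'

/-- The single-site reference measure `s δ₀ + dt` on `[0, ∞)`. -/
def siteMeasure (s : ℝ) : Measure ℝ≥0 :=
  ENNReal.ofReal s • Measure.dirac (0 : ℝ≥0) + halfLineLebesgue

instance (s : ℝ) : IsFiniteMeasureOnCompacts (siteMeasure s) where
  lt_top_of_isCompact K hK := by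
    rw [siteMeasure, Measure.add_apply, Measure.smul_apply, smul_eq_mul]
    exact ENNReal.add_lt_top.2 ⟨ENNReal.mul_lt_top ENNReal.ofReal_lt_top (measure_lt_top _ _),
      hK.measure_lt_top⟩

instance (s : ℝ) : (siteMeasure s).IsOpenPosMeasure where
  open_pos U hU hne := by
    have h := hU.measure_pos halfLineLebesgue hne
    rw [siteMeasure, Measure.add_apply]
    exact (h.trans_le le_add_self).ne'

/-- The condition `h 0 = 0` removes the atom, and `{0}` is Lebesgue null. -/
theorem integral_siteMeasure_of_zero {s : ℝ} {h : ℝ≥0 → ℝ} (h0 : h 0 = 0)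
    (hi : Integrable h (siteMeasure s)) :
    IntegrableOn (fun t : ℝ => h t.toNNReal) (Ioi 0) ∧
      ∫ t, h t ∂(siteMeasure s) = ∫ t in Ioi (0 : ℝ), h t.toNNReal := by
  have hi' := integrable_add_measure.1 hi
  have he : ∀ t : ℝ≥0, h t = (fun r : ℝ => h r.toNNReal) (t : ℝ) := fun t => by simp
  have h1 : IntegrableOn (fun t : ℝ => h t.toNNReal) (Ici 0) := by
    rw [IntegrableOn, ← map_halfLineLebesgue, measurableEmbedding_coe.integrable_map_iff]
    exact hi'.2.congr (Eventually.of_forall he)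
  refine ⟨h1.mono_set Ioi_subset_Ici_self, ?_⟩
  rw [siteMeasure, integral_add_measure hi'.1 hi'.2, integral_smul_measure, integral_dirac, h0,
    smul_zero, zero_add, ← integral_Ici_eq_integral_Ioi, ← map_halfLineLebesgue,
    measurableEmbedding_coe.integral_map]
  simp

variable {ι : Type*}

/-- The face-free part `{φ_x > 0}` of the orthant. -/
def posSet (x : ι) : Set (ι → ℝ≥0) := {φ | 0 < φ x}

theorem isOpen_posSet (x : ι) : IsOpen (posSet x) :=
  isOpen_lt continuous_const (continuous_apply x)

theorem measurableSet_posSet [Countable ι] (x : ι) : MeasurableSet (posSet x) :=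
  (isOpen_posSet x).measurableSet

theorem isClosedEmbedding_update [DecidableEq ι] (φ : ι → ℝ≥0) (x : ι) :
    IsClosedEmbedding fun t : ℝ≥0 => Function.update φ x t :=
  (show Function.LeftInverse (fun ψ : ι → ℝ≥0 => ψ x) (fun t : ℝ≥0 => Function.update φ x t) from
    fun t => by simp).isClosedEmbedding (continuous_apply x) (continuous_const.update x continuous_id)

variable [Fintype ι]

/-- The reference measure `∏ (s δ₀ + dφ_x)`. -/
def piRef (ι : Type*) [Fintype ι] (s : ℝ) : Measure (ι → ℝ≥0) := Measure.pi fun _ => siteMeasure s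

instance (s : ℝ) : IsLocallyFiniteMeasure (piRef ι s) := by unfold piRef; infer_instance

instance (s : ℝ) : (piRef ι s).IsOpenPosMeasure := by unfold piRef; infer_instance

variable [DecidableEq ι]

/-- Marginals act on `ℝ≥0∞`-valued functions, so a vanishing integral is used as equality of its
positive and negative parts. -/
theorem lintegral_ofReal_eq_of_integral_eq_zero {α : Type*} [MeasurableSpace α] {m : Measure α}
    {f : α → ℝ} (hf : Integrable f m) (h : ∫ a, f a ∂m = 0) :
    ∫⁻ a, ENNReal.ofReal (f a) ∂m = ∫⁻ a, ENNReal.ofReal (-f a) ∂m := by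
  rw [integral_eq_lintegral_pos_part_sub_lintegral_neg_part hf, sub_eq_zero] at h
  refine (ENNReal.toReal_eq_toReal_iff' ?_ ?_).1 h
  · exact hf.lintegral_lt_top.ne
  · exact hf.neg.lintegral_lt_top.ne

/-- The integral of a partial derivative over `{φ_x > 0}` vanishes for a compactly supported
function that vanishes on the face `{φ_x = 0}`. -/
theorem integral_posSet_deriv_eq_zero (s : ℝ) (x : ι) {G G' : (ι → ℝ≥0) → ℝ} (hG : Continuous G)
    (hG' : Continuous G') (hcG : HasCompactSupport G) (hcG' : HasCompactSupport G')
    (h0 : ∀ φ, φ x = 0 → G φ = 0)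
    (hd : ∀ φ, ∀ t : ℝ, 0 < t → HasDerivAt (fun t : ℝ => G (Function.update φ x t.toNNReal))
      (G' (Function.update φ x t.toNNReal)) t) :
    ∫ φ in posSet x, G' φ ∂(piRef ι s) = 0 := by
  rw [← integral_indicator (measurableSet_posSet x)]
  set f := (posSet x).indicator G' with hf
  have hfm : Measurable f := hG'.measurable.indicator (measurableSet_posSet x)
  have hfi : Integrable f (piRef ι s) :=
    (hG'.integrable_of_hasCompactSupport hcG').indicator (measurableSet_posSet x)
  -- The integral already vanishes on every line parallel to the `x`-axis.
  have key : ∀ φ, Integrable (fun t => f (Function.update φ x t)) (siteMeasure s) ∧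
      ∫ t, f (Function.update φ x t) ∂(siteMeasure s) = 0 := by
    intro φ
    have hce := isClosedEmbedding_update φ x
    have hfe : (fun t => f (Function.update φ x t)) =
        (Ioi 0).indicator fun t => G' (Function.update φ x t) := by
      funext t
      by_cases ht : 0 < t
      · rw [hf, indicator_of_mem (show Function.update φ x t ∈ posSet x by simpa [posSet] using ht),
          indicator_of_mem (mem_Ioi.2 ht)]
      · rw [hf, indicator_of_notMem
          (show Function.update φ x t ∉ posSet x by simpa [posSet] using ht),
          indicator_of_notMem (by simpa using ht)]
    have hi : Integrable (fun t => f (Function.update φ x t)) (siteMeasure s) := by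
      rw [hfe]
      exact ((hG'.comp hce.continuous).integrable_of_hasCompactSupport
        (hcG'.comp_isClosedEmbedding hce)).indicator measurableSet_Ioi
    refine ⟨hi, ?_⟩
    obtain ⟨hi1, hi2⟩ := integral_siteMeasure_of_zero (by rw [congrFun hfe 0]; simp) hi
    rw [hi2]
    have heq : EqOn (fun t : ℝ => f (Function.update φ x t.toNNReal))
        (fun t : ℝ => G' (Function.update φ x t.toNNReal)) (Ioi 0) := by
      intro t ht
      have := congrFun hfe t.toNNReal
      simp only at this ⊢
      rw [this, indicator_of_mem]
      simpa using ht
    rw [setIntegral_congr_fun measurableSet_Ioi heq]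
    obtain ⟨R, hR⟩ := (hcG.comp_isClosedEmbedding hce).isCompact.bddAbove
    have hlim : Tendsto (fun t : ℝ => G (Function.update φ x t.toNNReal)) atTop (𝓝 0) := by
      refine tendsto_const_nhds.congr' ?_
      filter_upwards [eventually_gt_atTop (R : ℝ)] with t ht
      by_contra hne
      have : t.toNNReal ≤ R := hR (subset_tsupport _ (fun h => hne h.symm))
      exact absurd (Real.toNNReal_le_iff_le_coe.1 this) (not_le.2 ht)
    -- The boundary term at infinity vanishes by compact support, the one at `0` by `h0`.
    rw [integral_Ioi_of_hasDerivAt_of_tendsto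
      (hG.comp (continuous_update_toNNReal φ x)).continuousWithinAt (hd φ)
      (hi1.congr_fun heq measurableSet_Ioi) hlim]
    simp [h0]
  rw [integral_eq_lintegral_pos_part_sub_lintegral_neg_part hfi, sub_eq_zero]
  congr 1
  -- Fubini: equality of the marginals in the variable `φ_x` suffices.
  refine lintegral_eq_of_lmarginal_eq {x} hfm.ennreal_ofReal hfm.neg.ennreal_ofReal ?_
  rw [lmarginal_singleton, lmarginal_singleton]
  funext φ
  exact lintegral_ofReal_eq_of_integral_eq_zero (key φ).1 (key φ).2

/-- Covers the factor `F = 1`, which need not have compact support and so is outside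
`IsCc.integral_pderiv_mul`. -/
theorem IsCc.integral_pderiv_eq_zero {Ψ : (ι → ℝ≥0) → ℝ} (hΨ : IsCc 2 Ψ) (s : ℝ) {x : ι}
    (h0 : ∀ φ, φ x = 0 → Ψ φ = 0) : ∫ φ in posSet x, pderiv x Ψ φ ∂(piRef ι s) = 0 :=
  integral_posSet_deriv_eq_zero s x hΨ.continuous (hΨ.continuous_pderiv x) hΨ.compactSupport
    (hΨ.hasCompactSupport_pderiv x) h0 fun φ _ ht => hΨ.hasDerivAt x φ ht

/-- Integration by parts in the variable `φ_x`. -/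
theorem IsCc.integral_pderiv_mul {F Ψ : (ι → ℝ≥0) → ℝ} (hF : IsCc 2 F) (hΨ : IsCc 2 Ψ) (s : ℝ)
    {x : ι} (h0 : ∀ φ, φ x = 0 → Ψ φ = 0) :
    ∫ φ in posSet x, (pderiv x F φ * Ψ φ + F φ * pderiv x Ψ φ) ∂(piRef ι s) = 0 := by
  refine integral_posSet_deriv_eq_zero s x (G := fun φ => F φ * Ψ φ)
    (hF.continuous.mul hΨ.continuous)
    (((hF.continuous_pderiv x).mul hΨ.continuous).add (hF.continuous.mul (hΨ.continuous_pderiv x)))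
    (hF.compactSupport.mul_right) ?_ (fun φ h => by rw [h0 φ h, mul_zero])
    fun φ t ht => (hF.hasDerivAt x φ ht).mul (hΨ.hasDerivAt x φ ht)
  exact (hΨ.compactSupport.mul_left).add (hF.compactSupport.mul_right)

end Reference

/-! ### The gradient and its closure -/

section Gradient

theorem hasCompactSupport_div {X : Type*} [TopologicalSpace X] {f : X → ℝ} (hf : HasCompactSupport f)
    (ρ : X → ℝ) : HasCompactSupport fun φ => f φ / ρ φ := by
  simp only [div_eq_mul_inv]
  exact hf.mul_right

variable {ι : Type*} [Fintype ι]

/-- `μ` has a continuous, strictly positive density `ρ` with respect to the reference measure. -/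
structure HasPosDensity (s : ℝ) (ρ : (ι → ℝ≥0) → ℝ) (μ : Measure (ι → ℝ≥0)) : Prop where
  continuous : Continuous ρ
  pos : ∀ φ, 0 < ρ φ
  eq : μ = (piRef ι s).withDensity fun φ => ENNReal.ofReal (ρ φ)

/-- The space of square integrable gradients; the component at `x` lives on `{φ_x > 0}`. -/
abbrev GradSpace (μ : Measure (ι → ℝ≥0)) : Type _ :=
  PiLp 2 fun x : ι => Lp ℝ 2 (μ.restrict (posSet x))

variable {s : ℝ} {ρ : (ι → ℝ≥0) → ℝ} {μ : Measure (ι → ℝ≥0)}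

/-- Dividing by `ρ` trades `μ` for the reference measure, for which integration by parts has no
drift term. -/
theorem HasPosDensity.setIntegral_div (h : HasPosDensity s ρ μ) {A : Set (ι → ℝ≥0)}
    (hA : MeasurableSet A) (f : (ι → ℝ≥0) → ℝ) :
    ∫ φ in A, f φ / ρ φ ∂μ = ∫ φ in A, f φ ∂(piRef ι s) := by
  rw [h.eq, setIntegral_withDensity_eq_setIntegral_toReal_smul
    h.continuous.measurable.ennreal_ofReal (Eventually.of_forall fun _ => ENNReal.ofReal_lt_top)
    _ hA]
  congr 1
  funext φ
  rw [ENNReal.toReal_ofReal (h.pos φ).le, smul_eq_mul, mul_div_cancel₀ _ (h.pos φ).ne']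

theorem HasPosDensity.isOpenPosMeasure (h : HasPosDensity s ρ μ) : μ.IsOpenPosMeasure := by
  have hac : piRef ι s ≪ μ := by
    rw [h.eq]
    refine withDensity_absolutelyContinuous' h.continuous.measurable.ennreal_ofReal.aemeasurable ?_
    exact Eventually.of_forall fun φ => by simpa using h.pos φ
  exact hac.isOpenPosMeasure

theorem HasPosDensity.continuous_div (h : HasPosDensity s ρ μ) {f : (ι → ℝ≥0) → ℝ}
    (hf : Continuous f) : Continuous fun φ => f φ / ρ φ :=
  hf.div h.continuous fun φ => (h.pos φ).ne'

variable [DecidableEq ι]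

/-- The graph of the gradient on `C_c^2`. -/
def gradGraph (μ : Measure (ι → ℝ≥0)) : Submodule ℝ (Lp ℝ 2 μ × GradSpace μ) where
  carrier := {z | ∃ F : (ι → ℝ≥0) → ℝ, IsCc 2 F ∧ z.1 =ᵐ[μ] F ∧
    ∀ x, z.2 x =ᵐ[μ.restrict (posSet x)] pderiv x F}
  add_mem' := by
    rintro a b ⟨F, hF, h1, h2⟩ ⟨G, hG, h3, h4⟩
    refine ⟨F + G, hF.add hG, (Lp.coeFn_add _ _).trans (h1.add h3), fun x => ?_⟩
    rw [hF.pderiv_add hG]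
    exact (Lp.coeFn_add _ _).trans ((h2 x).add (h4 x))
  zero_mem' := by
    refine ⟨0, IsCc.zero, Lp.coeFn_zero _ _ _, fun x => ?_⟩
    have h : pderiv x (0 : (ι → ℝ≥0) → ℝ) = 0 := by
      have := (IsCc.zero (ι := ι)).pderiv_const_smul 0 x
      rwa [zero_smul, zero_smul] at this
    rw [h]
    exact Lp.coeFn_zero _ _ _
  smul_mem' := by
    rintro c a ⟨F, hF, h1, h2⟩
    refine ⟨c • F, hF.const_smul c, (Lp.coeFn_smul _ _).trans (h1.const_smul c), fun x => ?_⟩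
    rw [hF.pderiv_const_smul]
    exact (Lp.coeFn_smul _ _).trans ((h2 x).const_smul c)

variable [IsFiniteMeasure μ]

theorem IsCc.memLp {F : (ι → ℝ≥0) → ℝ} (hF : IsCc 2 F) (m : Measure (ι → ℝ≥0))
    [IsFiniteMeasure m] : MemLp F 2 m :=
  hF.continuous.memLp_of_hasCompactSupport hF.compactSupport

theorem IsCc.memLp_pderiv {F : (ι → ℝ≥0) → ℝ} (hF : IsCc 2 F) (x : ι) (m : Measure (ι → ℝ≥0))
    [IsFiniteMeasure m] : MemLp (pderiv x F) 2 m :=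
  (hF.continuous_pderiv x).memLp_of_hasCompactSupport (hF.hasCompactSupport_pderiv x)

/-- The gradient of a `C_c^2` function. -/
def IsCc.grad {F : (ι → ℝ≥0) → ℝ} (hF : IsCc 2 F) (μ : Measure (ι → ℝ≥0)) [IsFiniteMeasure μ] :
    GradSpace μ :=
  WithLp.toLp 2 fun x => (hF.memLp_pderiv x (μ.restrict (posSet x))).toLp

theorem IsCc.grad_apply_ae {F : (ι → ℝ≥0) → ℝ} (hF : IsCc 2 F) (x : ι) :
    hF.grad μ x =ᵐ[μ.restrict (posSet x)] pderiv x F :=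
  (hF.memLp_pderiv x (μ.restrict (posSet x))).coeFn_toLp

theorem IsCc.mem_gradGraph {F : (ι → ℝ≥0) → ℝ} (hF : IsCc 2 F) :
    ((hF.memLp μ).toLp, hF.grad μ) ∈ gradGraph μ :=
  ⟨F, hF, (hF.memLp μ).coeFn_toLp, fun x => hF.grad_apply_ae x⟩

theorem inner_toLp_eq {α : Type*} [MeasurableSpace α] {m : Measure α} {f : α → ℝ}
    (hf : MemLp f 2 m) (g : Lp ℝ 2 m) : inner ℝ hf.toLp g = ∫ a, g a * f a ∂m := by
  rw [L2.inner_def]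
  refine integral_congr_ae ?_
  filter_upwards [hf.coeFn_toLp] with a ha
  rw [ha]
  rfl

/-- Integration by parts for the closure of the gradient. -/
theorem integral_grad_mul (h : HasPosDensity s ρ μ) {z : Lp ℝ 2 μ × GradSpace μ}
    (hz : z ∈ (gradGraph μ).topologicalClosure) {Ψ : (ι → ℝ≥0) → ℝ} (hΨ : IsCc 2 Ψ) {x : ι}
    (h0 : ∀ φ, φ x = 0 → Ψ φ = 0) :
    ∫ φ in posSet x, z.2 x φ * (Ψ φ / ρ φ) ∂μ +
      ∫ φ in posSet x, z.1 φ * (pderiv x Ψ φ / ρ φ) ∂μ = 0 := by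
  have m1 : MemLp (fun φ => Ψ φ / ρ φ) 2 (μ.restrict (posSet x)) :=
    (h.continuous_div hΨ.continuous).memLp_of_hasCompactSupport
      (hasCompactSupport_div hΨ.compactSupport ρ)
  -- The indicator is needed because `z.1` lives in `L²(μ)`, not in `L²` of the restricted measure.
  have m2 : MemLp ((posSet x).indicator fun φ => pderiv x Ψ φ / ρ φ) 2 μ :=
    ((h.continuous_div (hΨ.continuous_pderiv x)).memLp_of_hasCompactSupport
      (hasCompactSupport_div (hΨ.hasCompactSupport_pderiv x) ρ)).indicator (measurableSet_posSet x)
  have e1 : ∀ w : Lp ℝ 2 μ × GradSpace μ, ∫ φ in posSet x, w.2 x φ * (Ψ φ / ρ φ) ∂μ =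
      inner ℝ m1.toLp (w.2 x) := fun w => (inner_toLp_eq m1 _).symm
  have e2 : ∀ w : Lp ℝ 2 μ × GradSpace μ, ∫ φ in posSet x, w.1 φ * (pderiv x Ψ φ / ρ φ) ∂μ =
      inner ℝ m2.toLp w.1 := fun w => by
    rw [inner_toLp_eq m2, ← integral_indicator (measurableSet_posSet x)]
    congr 1
    funext φ
    by_cases hφ : φ ∈ posSet x <;> simp [hφ]
  -- Written with inner products against fixed vectors, the identity is a closed condition on `w`,
  -- so it need only be checked on `gradGraph μ`.
  have hcl : IsClosed {w : Lp ℝ 2 μ × GradSpace μ |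
      inner ℝ m1.toLp (w.2 x) + inner ℝ m2.toLp w.1 = 0} := by
    refine isClosed_eq ?_ continuous_const
    have c1 : Continuous fun w : Lp ℝ 2 μ × GradSpace μ => w.2 x :=
      (PiLp.continuous_apply 2 _ x).comp continuous_snd
    exact (continuous_const.inner c1).add (continuous_const.inner continuous_fst)
  rw [e1, e2]
  refine closure_minimal ?_ hcl hz
  rintro w ⟨F, hF, hw1, hw2⟩
  change inner ℝ m1.toLp (w.2 x) + inner ℝ m2.toLp w.1 = 0
  rw [← e1, ← e2]
  have i1 : ∫ φ in posSet x, w.2 x φ * (Ψ φ / ρ φ) ∂μ =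
      ∫ φ in posSet x, (pderiv x F φ * Ψ φ) / ρ φ ∂μ := by
    refine integral_congr_ae ?_
    filter_upwards [hw2 x] with φ hφ
    rw [hφ, mul_div_assoc]
  have i2 : ∫ φ in posSet x, w.1 φ * (pderiv x Ψ φ / ρ φ) ∂μ =
      ∫ φ in posSet x, (F φ * pderiv x Ψ φ) / ρ φ ∂μ := by
    refine integral_congr_ae ?_
    filter_upwards [ae_restrict_of_ae hw1] with φ hφ
    rw [hφ, mul_div_assoc]
  rw [i1, i2, h.setIntegral_div (measurableSet_posSet x), h.setIntegral_div (measurableSet_posSet x),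
    ← integral_add, hF.integral_pderiv_mul hΨ s h0]
  · exact (((hF.continuous_pderiv x).mul hΨ.continuous).integrable_of_hasCompactSupport
      hΨ.compactSupport.mul_left).integrableOn
  · exact ((hF.continuous.mul (hΨ.continuous_pderiv x)).integrable_of_hasCompactSupport
      hF.compactSupport.mul_right).integrableOn

/-- The closure of the gradient is local. -/
theorem grad_eq_zero_of_const (h : HasPosDensity s ρ μ) {z : Lp ℝ 2 μ × GradSpace μ}
    (hz : z ∈ (gradGraph μ).topologicalClosure) {U : Set (ι → ℝ≥0)} (hU : IsOpen U) {c : ℝ}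
    (hc : ∀ᵐ φ ∂μ, φ ∈ U → z.1 φ = c) (x : ι) :
    ∀ᵐ φ ∂(μ.restrict (posSet x)), φ ∈ U → z.2 x φ = 0 := by
  have hemb : MeasurableEmbedding (emb : (ι → ℝ≥0) → ι → ℝ) :=
    isClosedEmbedding_emb.measurableEmbedding
  -- Smooth functions supported in `W` restrict to admissible test functions: they vanish on `{φ_x =
  -- 0}`, while the other coordinates may reach their faces.
  let W : Set (ι → ℝ) := retr ⁻¹' U ∩ {u | 0 < u x}
  have hW : IsOpen W :=
    (hU.preimage continuous_retr).inter (isOpen_lt continuous_const (continuous_apply x))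
  let m : Measure (ι → ℝ) := (μ.restrict (posSet x)).map emb
  -- The factor `1 / ρ` matches the test functions `Ψ / ρ` of `integral_grad_mul`.
  let f : (ι → ℝ) → ℝ := fun u => z.2 x (retr u) * (1 / ρ (retr u))
  have hf : LocallyIntegrableOn f W m := by
    have h1 : Integrable (fun u => z.2 x (retr u)) m := by
      rw [hemb.integrable_map_iff]
      refine ((Lp.memLp (z.2 x)).integrable one_le_two).congr (Eventually.of_forall fun φ => ?_)
      simp [retr_emb]
    have h2 : Continuous fun u : ι → ℝ => 1 / ρ (retr u) :=
      (h.continuous_div continuous_const).comp continuous_retr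
    exact (h1.locallyIntegrable.locallyIntegrableOn W).mul_continuousOn h2.continuousOn
      hW.isLocallyClosed
  have key : ∀ᵐ u ∂m, u ∈ W → f u = 0 := by
    -- Fundamental lemma of the calculus of variations.
    refine hW.ae_eq_zero_of_integral_contDiff_smul_eq_zero hf fun ψ hψ hψc hψW => ?_
    have hψ2 : ContDiff ℝ 2 ψ := contDiff_infty.1 hψ 2
    have hΨ : IsCc 2 fun φ => ψ (emb φ) := IsCc.of_contDiff hψ2 hψc
    have hts : tsupport (fun φ => ψ (emb φ)) ⊆ emb ⁻¹' tsupport ψ :=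
      tsupport_comp_subset_preimage ψ continuous_emb
    have h0 : ∀ φ : ι → ℝ≥0, φ x = 0 → ψ (emb φ) = 0 := by
      intro φ hφ
      refine image_eq_zero_of_notMem_tsupport fun hm => ?_
      have := (hψW hm).2
      simp [emb, hφ] at this
    rw [hemb.integral_map]
    have e1 : ∫ φ in posSet x, ψ (emb φ) • f (emb φ) ∂μ =
        ∫ φ in posSet x, z.2 x φ * (ψ (emb φ) / ρ φ) ∂μ := by
      congr 1
      funext φ
      simp only [f, retr_emb, smul_eq_mul]
      ring
    -- On `U` the first component is `c`; off `U` the derivative of the test function vanishes.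
    have e2 : ∫ φ in posSet x, z.1 φ * (pderiv x (fun φ => ψ (emb φ)) φ / ρ φ) ∂μ =
        ∫ φ in posSet x, c * (pderiv x (fun φ => ψ (emb φ)) φ / ρ φ) ∂μ := by
      refine integral_congr_ae ?_
      filter_upwards [ae_restrict_of_ae hc] with φ hφ
      by_cases hφU : φ ∈ U
      · rw [hφ hφU]
      · have : pderiv x (fun φ => ψ (emb φ)) φ = 0 := by
          refine image_eq_zero_of_notMem_tsupport fun hm => hφU ?_
          have := (hψW (hts (hΨ.tsupport_pderiv_subset x hm))).1
          rwa [mem_preimage, retr_emb] at this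
        simp [this]
    have e3 := integral_grad_mul h hz hΨ h0
    rw [e2, integral_const_mul, h.setIntegral_div (measurableSet_posSet x),
      hΨ.integral_pderiv_eq_zero s h0, mul_zero, add_zero] at e3
    rw [e1, e3]
  rw [hemb.ae_map_iff] at key
  filter_upwards [key, ae_restrict_mem (measurableSet_posSet x)] with φ hφ hφx hφU
  have := hφ ⟨by rwa [mem_preimage, retr_emb], NNReal.coe_pos.2 hφx⟩
  simp only [f, retr_emb, mul_eq_zero, one_div, inv_eq_zero, (h.pos φ).ne', or_false] at this
  exact this

/-- This is locality on the whole space with constant `0`. -/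
theorem isFunctional_closure_gradGraph (h : HasPosDensity s ρ μ) :
    IsFunctional (gradGraph μ).topologicalClosure := by
  intro z hz hz0
  ext1 x
  have h1 : ∀ᵐ φ ∂μ, φ ∈ (univ : Set (ι → ℝ≥0)) → z.1 φ = 0 := by
    rw [hz0]
    filter_upwards [Lp.coeFn_zero ℝ 2 μ] with φ hφ _ using hφ
  have h2 := grad_eq_zero_of_const h hz isOpen_univ h1 x
  refine Lp.ext ?_
  filter_upwards [h2, Lp.coeFn_zero ℝ 2 (μ.restrict (posSet x))] with φ hφ hφ0
  rw [hφ (mem_univ _)]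
  exact hφ0.symm

end Gradient

/-! ### Approximation by `C_c^2` functions -/

section Approximation

/-- A smooth approximation of the unit contraction by normal contractions. -/
theorem exists_smooth_unit_contraction {ε : ℝ} (hε : 0 < ε) : ∃ j : ℝ → ℝ, ContDiff ℝ 2 j ∧
    j 0 = 0 ∧ (∀ t, |deriv j t| ≤ 1) ∧ ∀ t, |j t - min (max t 0) 1| ≤ ε := by
  -- The contraction `j` is the primitive of a bump equal to `1` on `[0, 1]` and vanishing off `(-ε,
  -- 1 + ε)`; each transition interval of length `ε` contributes at most `ε`.
  let f : ContDiffBump (1 / 2 : ℝ) := ⟨1 / 2, 1 / 2 + ε, by norm_num, by linarith⟩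
  have hfc : Continuous f := f.continuous
  have hi : ∀ a b, IntervalIntegrable f volume a b := fun a b => hfc.intervalIntegrable a b
  have hd : ∀ t, HasDerivAt (fun t => ∫ r in (0 : ℝ)..t, f r) (f t) t := fun t =>
    intervalIntegral.integral_hasDerivAt_right (hi 0 t) (hfc.stronglyMeasurableAtFilter _ _)
      hfc.continuousAt
  have hd' : deriv (fun t => ∫ r in (0 : ℝ)..t, f r) = f := funext fun t => (hd t).deriv
  have hb : ∀ t, ‖f t‖ ≤ 1 := fun t => by
    rw [Real.norm_eq_abs, abs_le]; exact ⟨by linarith [f.nonneg' t], f.le_one⟩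
  have h1 : ∀ a b, 0 ≤ a → a ≤ b → b ≤ 1 → ∫ r in a..b, f r = b - a := by
    intro a b ha hab hb1
    have : EqOn f (fun _ => (1 : ℝ)) (uIcc a b) := by
      intro r hr
      rw [uIcc_of_le hab] at hr
      refine f.one_of_mem_closedBall ?_
      rw [Metric.mem_closedBall, Real.dist_eq, abs_le]
      constructor <;> simp only [f] <;> linarith [hr.1, hr.2]
    rw [intervalIntegral.integral_congr this]
    simp
  have h0 : ∀ a b, (∀ r ∈ uIcc a b, 1 / 2 + ε ≤ |r - 1 / 2|) → ∫ r in a..b, f r = 0 := by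
    intro a b hr
    have : EqOn f (fun _ => (0 : ℝ)) (uIcc a b) := fun r hr' =>
      f.zero_of_le_dist (by rw [Real.dist_eq]; exact hr r hr')
    rw [intervalIntegral.integral_congr this]
    simp
  have hle : ∀ a b, |b - a| ≤ ε → |∫ r in a..b, f r| ≤ ε := fun a b hab => by
    have := intervalIntegral.norm_integral_le_of_norm_le_const (a := a) (b := b) (C := 1)
      (f := f) fun x _ => hb x
    rw [one_mul] at this
    exact this.trans hab
  refine ⟨fun t => ∫ r in (0 : ℝ)..t, f r, ?_, by simp, fun t => ?_, fun t => ?_⟩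
  · have : ContDiff ℝ (1 + 1) fun t => ∫ r in (0 : ℝ)..t, f r := by
      rw [contDiff_succ_iff_deriv, hd']
      exact ⟨fun t => (hd t).differentiableAt, by simp, f.contDiff⟩
    simpa [one_add_one_eq_two] using this
  · rw [hd']; exact hb t
  beta_reduce
  rcases le_total t 0 with ht | ht
  · rw [max_eq_right ht, min_eq_left zero_le_one, sub_zero]
    rcases le_total (-ε) t with htε | htε
    · exact hle 0 t (by rw [abs_le]; constructor <;> linarith)
    · rw [← intervalIntegral.integral_add_adjacent_intervals (hi 0 (-ε)) (hi (-ε) t),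
        h0 (-ε) t, add_zero]
      · exact hle _ _ (by rw [abs_le]; constructor <;> linarith)
      · intro r hr
        rw [uIcc_of_ge htε] at hr
        exact le_abs.2 (Or.inr (by linarith [hr.2]))
  rw [max_eq_left ht]
  rcases le_total t 1 with ht1 | ht1
  · rw [min_eq_left ht1, h1 0 t le_rfl ht ht1]
    simpa using hε.le
  · rw [min_eq_right ht1, ← intervalIntegral.integral_add_adjacent_intervals (hi 0 1) (hi 1 t),
      h1 0 1 le_rfl zero_le_one le_rfl]
    have : (1 - 0 + ∫ r in (1 : ℝ)..t, f r) - 1 = ∫ r in (1 : ℝ)..t, f r := by ring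
    rw [this]
    rcases le_total t (1 + ε) with htε | htε
    · exact hle 1 t (by rw [abs_le]; constructor <;> linarith)
    · rw [← intervalIntegral.integral_add_adjacent_intervals (hi 1 (1 + ε)) (hi (1 + ε) t),
        h0 (1 + ε) t, add_zero]
      · exact hle _ _ (by rw [abs_le]; constructor <;> linarith)
      · intro r hr
        rw [uIcc_of_le htε] at hr
        exact le_abs.2 (Or.inl (by linarith [hr.1]))

theorem abs_unit_contraction_sub_le (a b : ℝ) :
    |min (max a 0) 1 - min (max b 0) 1| ≤ |a - b| :=
  (abs_min_sub_min_le_max _ _ _ _).trans (by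
    rw [sub_self, abs_zero, max_eq_left (abs_nonneg _)]
    exact (abs_max_sub_max_le_max _ _ _ _).trans (by
      rw [sub_self, abs_zero, max_eq_left (abs_nonneg _)]))

theorem norm_sq_eq_integral {α : Type*} [MeasurableSpace α] {m : Measure α} (f : Lp ℝ 2 m) :
    ‖f‖ ^ 2 = ∫ a, f a ^ 2 ∂m := by
  rw [← real_inner_self_eq_norm_sq, L2.inner_def]
  congr 1
  funext a
  simp [sq]

/-- The constant function `1` as an element of `L²`. -/
def one {α : Type*} [MeasurableSpace α] (m : Measure α) [IsFiniteMeasure m] : Lp ℝ 2 m :=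
  (memLp_const (1 : ℝ)).toLp

theorem one_ae {α : Type*} [MeasurableSpace α] {m : Measure α} [IsFiniteMeasure m] :
    ∀ᵐ a ∂m, one m a = 1 :=
  (memLp_const (1 : ℝ)).coeFn_toLp

variable {ι : Type*} [Fintype ι] [DecidableEq ι]

/-- `C_c^2` is uniformly dense in `C_c`. -/
theorem exists_isCc_approx {f : (ι → ℝ≥0) → ℝ} (hf : Continuous f) (hc : HasCompactSupport f)
    {ε : ℝ} (hε : 0 < ε) : ∃ F : (ι → ℝ≥0) → ℝ, IsCc 2 F ∧ ∀ φ, |f φ - F φ| < ε := by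
  -- Even reflection extends `f` continuously to `ℝ^ι` and preserves the sup norm of points, hence
  -- bounded support.
  let h : (ι → ℝ) → ℝ := fun u => f fun x => Real.nnabs (u x)
  have hh : Continuous h :=
    hf.comp (continuous_pi fun x => by
      exact (continuous_abs.comp (continuous_apply x)).subtype_mk _)
  obtain ⟨R, hR⟩ := (hc.isCompact.image continuous_emb).isBounded.subset_closedBall 0
  have hhs : Function.support h ⊆ Metric.closedBall 0 R := by
    intro u hu
    have h1 := hR ⟨_, subset_tsupport f hu, rfl⟩
    rw [mem_closedBall_zero_iff] at h1 ⊢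
    refine le_trans (le_of_eq ?_) h1
    simp only [Pi.norm_def, emb]
    congr 2
    funext x
    ext
    simp
  obtain ⟨g, hg, hgd, hgs⟩ := hh.exists_contDiff_approx 2 (ε := fun _ => ε) continuous_const
    fun _ => hε
  refine ⟨fun φ => g (emb φ), IsCc.of_contDiff hg
    (HasCompactSupport.of_support_subset_isCompact (isCompact_closedBall 0 R) (hgs.trans hhs)),
    fun φ => ?_⟩
  have h1 := hgd (emb φ)
  have h2 : h (emb φ) = f φ := by
    refine congrArg f (funext fun x => ?_)
    simp [emb]
  rwa [Real.dist_eq, abs_sub_comm, h2] at h1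

variable {s : ℝ} {ρ : (ι → ℝ≥0) → ℝ} {μ : Measure (ι → ℝ≥0)} [IsFiniteMeasure μ]

/-- `C_c^2` is dense in `L²`. -/
theorem exists_isCc_norm_sub_lt (u : Lp ℝ 2 μ) {ε : ℝ} (hε : 0 < ε) :
    ∃ (F : (ι → ℝ≥0) → ℝ) (hF : IsCc 2 F), ‖u - (hF.memLp μ).toLp‖ < ε := by
  have hemb : MeasurableEmbedding (emb : (ι → ℝ≥0) → ι → ℝ) :=
    isClosedEmbedding_emb.measurableEmbedding
  have hu : (u ∘ retr) ∘ emb = u := funext fun φ => congrArg u (retr_emb φ)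
  -- Pushing `μ` forward along `emb` reduces the claim to density of smooth compactly supported
  -- functions on `ℝ^ι`.
  have hm : MemLp (u ∘ retr) 2 (μ.map emb) := by
    rw [hemb.memLp_map_measure_iff, hu]
    exact Lp.memLp u
  obtain ⟨g, hgc, hg, hgn⟩ := hm.exist_eLpNorm_sub_le ENNReal.ofNat_ne_top one_le_two
    (half_pos hε)
  have hF : IsCc 2 fun φ => g (emb φ) := IsCc.of_contDiff (contDiff_infty.1 hg 2) hgc
  refine ⟨_, hF, ?_⟩
  rw [hemb.eLpNorm_map_measure] at hgn
  have h1 : u - (hF.memLp μ).toLp = ((Lp.memLp u).sub (hF.memLp μ)).toLp := by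
    rw [MemLp.toLp_sub (Lp.memLp u) (hF.memLp μ), Lp.toLp_coeFn]
  rw [h1, Lp.norm_toLp]
  have h2 : (u ∘ retr - g) ∘ emb = (u : (ι → ℝ≥0) → ℝ) - fun φ => g (emb φ) := by
    funext φ
    simp [retr_emb]
  rw [h2] at hgn
  refine (ENNReal.toReal_le_of_le_ofReal (half_pos hε).le hgn).trans_lt (half_lt_self hε)

/-- The cutoffs `χ(a n • φ)` tend to `1` boundedly, hence in `L²` since `μ` is finite, and their
partial derivatives are at most `a n * C`. -/
theorem one_mem_closure : (one μ, (0 : GradSpace μ)) ∈ (gradGraph μ).topologicalClosure := by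
  let χ : ContDiffBump (0 : ι → ℝ) := ⟨1, 2, one_pos, one_lt_two⟩
  let a : ℕ → ℝ := fun n => ((n : ℝ) + 1)⁻¹
  have ha0 : ∀ n, 0 < a n := fun n => by positivity
  have ha : Tendsto a atTop (𝓝 0) := by
    simpa [a] using tendsto_one_div_add_atTop_nhds_zero_nat (𝕜 := ℝ)
  let χn : ℕ → (ι → ℝ) → ℝ := fun n u => χ (a n • u)
  have hχn : ∀ n, ContDiff ℝ 2 (χn n) := fun n => χ.contDiff.comp (contDiff_const_smul (a n))
  have hχc : ∀ n, HasCompactSupport (χn n) := fun n =>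
    χ.hasCompactSupport.comp_homeomorph (Homeomorph.smulOfNeZero (a n) (ha0 n).ne')
  have hF : ∀ n, IsCc 2 fun φ => χn n (emb φ) := fun n => IsCc.of_contDiff (hχn n) (hχc n)
  obtain ⟨C, hC⟩ := (χ.hasCompactSupport.fderiv ℝ).exists_bound_of_continuous
    (χ.contDiff.continuous_fderiv (n := 1) one_ne_zero)
  have hC0 : 0 ≤ C := (norm_nonneg _).trans (hC 0)
  have hgrad : ∀ n x φ, |pderiv x (fun φ => χn n (emb φ)) φ| ≤ a n * C := by
    intro n x φ
    rw [IsCc.pderiv_of_contDiff (hχn n)]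
    have hd : HasFDerivAt (χn n) (a n • fderiv ℝ χ (a n • emb φ)) (emb φ) := by
      have h1 : HasFDerivAt χ (fderiv ℝ χ (a n • emb φ)) (a n • emb φ) :=
        ((χ.contDiff (n := 1)).differentiable one_ne_zero _).hasFDerivAt
      have h2 : HasFDerivAt (fun u : ι → ℝ => a n • u) (a n • ContinuousLinearMap.id ℝ (ι → ℝ))
        (emb φ) := (hasFDerivAt_id _).const_smul (a n)
      have h3 := h1.comp (emb φ) h2
      rwa [ContinuousLinearMap.comp_smul, ContinuousLinearMap.comp_id] at h3
    beta_reduce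
    rw [hd.fderiv, ← Real.norm_eq_abs]
    refine (ContinuousLinearMap.le_opNorm _ _).trans ?_
    rw [norm_smul, Real.norm_of_nonneg (ha0 n).le, Pi.norm_single, norm_one, mul_one]
    gcongr
    exact hC _
  refine mem_closure_of_tendsto (b := atTop)
    (f := fun n => (((hF n).memLp μ).toLp, (hF n).grad μ)) ?_
    (Eventually.of_forall fun n => (hF n).mem_gradGraph)
  refine Tendsto.prodMk_nhds ?_ ?_
  · rw [tendsto_iff_norm_sub_tendsto_zero]
    have hsq : Tendsto (fun n => ‖((hF n).memLp μ).toLp - one μ‖ ^ 2) atTop (𝓝 0) := by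
      have e : ∀ n, ‖((hF n).memLp μ).toLp - one μ‖ ^ 2 = ∫ φ, (χn n (emb φ) - 1) ^ 2 ∂μ := by
        intro n
        rw [norm_sq_eq_integral]
        refine integral_congr_ae ?_
        filter_upwards [Lp.coeFn_sub ((hF n).memLp μ).toLp (one μ), ((hF n).memLp μ).coeFn_toLp,
          one_ae (m := μ)] with φ h1 h2 h3
        rw [h1, Pi.sub_apply, h2, h3]
      simp only [e]
      rw [← integral_zero (ι → ℝ≥0) ℝ (μ := μ)]
      refine tendsto_integral_of_dominated_convergence (fun _ => 1) (fun n => ?_)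
        (integrable_const _) (fun n => Eventually.of_forall fun φ => ?_)
        (Eventually.of_forall fun φ => ?_)
      · exact ((hF n).continuous.sub continuous_const).pow 2 |>.aestronglyMeasurable
      · rw [Real.norm_of_nonneg (sq_nonneg _)]
        have h1 : 0 ≤ χn n (emb φ) := χ.nonneg
        have h2 : χn n (emb φ) ≤ 1 := χ.le_one
        nlinarith
      · have h1 : Tendsto (fun n => χn n (emb φ)) atTop (𝓝 (χ 0)) := by
          refine (χ.continuous.tendsto _).comp ?_
          simpa using ha.smul_const (emb φ)
        have h2 : χ 0 = 1 := χ.one_of_mem_closedBall (by simp [χ])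
        rw [h2] at h1
        simpa using (h1.sub_const 1).pow 2
    simpa [Real.sqrt_sq] using hsq.sqrt
  · have hx : ∀ x, Tendsto (fun n => (hF n).grad μ x) atTop (𝓝 0) := by
      intro x
      rw [tendsto_zero_iff_norm_tendsto_zero]
      have hb : ∀ n, ‖(hF n).grad μ x‖ ≤
          (measureUnivNNReal (μ.restrict (posSet x)) : ℝ) ^ (2 : ℝ≥0∞).toReal⁻¹ * (a n * C) := by
        intro n
        refine Lp.norm_le_of_ae_bound (mul_nonneg (ha0 n).le hC0) ?_
        filter_upwards [(hF n).grad_apply_ae (μ := μ) x] with φ hφ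
        rw [hφ]
        exact hgrad n x φ
      refine squeeze_zero (fun n => norm_nonneg _) hb ?_
      simpa using (ha.mul_const C).const_mul
        ((measureUnivNNReal (μ.restrict (posSet x)) : ℝ) ^ (2 : ℝ≥0∞).toReal⁻¹)
    have h1 : Tendsto (fun n => WithLp.ofLp ((hF n).grad μ)) atTop (𝓝 0) :=
      tendsto_pi_nhds.2 fun x => hx x
    exact ((PiLp.continuous_toLp 2 fun x : ι => Lp ℝ 2 (μ.restrict (posSet x))).tendsto 0).comp h1

end Approximation

/-! ### The Dirichlet form of a measure with positive density -/

section DirichletForm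

open L2Form

variable {ι : Type*} [Fintype ι] [DecidableEq ι] {s : ℝ} {ρ : (ι → ℝ≥0) → ℝ}
  {μ : Measure (ι → ℝ≥0)}

/-- The pre-Dirichlet form, with domain `C_c^2`. -/
abbrev preForm (μ : Measure (ι → ℝ≥0)) : L2Form μ := ofGraph (gradGraph μ)

/-- The closure of the pre-Dirichlet form. -/
abbrev closedForm (μ : Measure (ι → ℝ≥0)) : L2Form μ := ofGraph (gradGraph μ).topologicalClosure

variable [IsFiniteMeasure μ]

theorem mem_gradGraph_of_ae {u : Lp ℝ 2 μ} {F : (ι → ℝ≥0) → ℝ} (hF : IsCc 2 F) (hu : u =ᵐ[μ] F) :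
    (u, hF.grad μ) ∈ gradGraph μ :=
  ⟨F, hF, hu, fun x => hF.grad_apply_ae x⟩

theorem mem_preForm_domain {u : Lp ℝ 2 μ} :
    u ∈ (preForm μ).domain ↔ ∃ F : (ι → ℝ≥0) → ℝ, IsCc 2 F ∧ u =ᵐ[μ] F := by
  rw [mem_ofGraph_domain]
  constructor
  · rintro ⟨g, F, hF, hu, -⟩
    exact ⟨F, hF, hu⟩
  · rintro ⟨F, hF, hu⟩
    exact ⟨_, mem_gradGraph_of_ae hF hu⟩

theorem HasPosDensity.isFunctional (h : HasPosDensity s ρ μ) : IsFunctional (gradGraph μ) :=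
  IsFunctional.mono (isFunctional_closure_gradGraph h) (Submodule.le_topologicalClosure _)

/-- Functionality of the graph makes the value independent of the representatives `F` and `G`. -/
theorem HasPosDensity.preForm_apply (h : HasPosDensity s ρ μ) {F G : (ι → ℝ≥0) → ℝ}
    (hF : IsCc 2 F) (hG : IsCc 2 G) (u v : (preForm μ).domain)
    (hu : (u : Lp ℝ 2 μ) =ᵐ[μ] F) (hv : (v : Lp ℝ 2 μ) =ᵐ[μ] G) :
    (preForm μ).form u v = ∑ x, ∫ φ in posSet x, pderiv x F φ * pderiv x G φ ∂μ := by
  have e1 := op_eq h.isFunctional (u := u) (mem_gradGraph_of_ae hF hu)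
  have e2 := op_eq h.isFunctional (u := v) (mem_gradGraph_of_ae hG hv)
  change inner ℝ (op (gradGraph μ) u) (op (gradGraph μ) v) = _
  rw [e1, e2, PiLp.inner_apply]
  refine Finset.sum_congr rfl fun x _ => ?_
  rw [L2.inner_def]
  refine integral_congr_ae ?_
  filter_upwards [hF.grad_apply_ae (μ := μ) x, hG.grad_apply_ae (μ := μ) x] with φ h1 h2
  rw [h1, h2]
  exact mul_comm _ _

theorem preForm_isDenselyDefined : (preForm μ).IsDenselyDefined := by
  intro u
  rw [Metric.mem_closure_iff]
  intro ε hε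
  obtain ⟨F, hF, h⟩ := exists_isCc_norm_sub_lt u hε
  exact ⟨_, mem_preForm_domain.2 ⟨F, hF, (hF.memLp μ).coeFn_toLp⟩, by rwa [dist_eq_norm]⟩

theorem HasPosDensity.isClosureOf (h : HasPosDensity s ρ μ) :
    (closedForm μ).IsClosureOf (preForm μ) :=
  ofGraph_isClosureOf (isFunctional_closure_gradGraph h)

theorem norm_grad_comp_le {F : (ι → ℝ≥0) → ℝ} (hF : IsCc 2 F) {j : ℝ → ℝ} (hj : ContDiff ℝ 2 j)
    (hj0 : j 0 = 0) (hj1 : ∀ t, |deriv j t| ≤ 1) :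
    ‖(hF.comp_left hj hj0).grad μ‖ ≤ ‖hF.grad μ‖ := by
  refine le_of_sq_le_sq ?_ (norm_nonneg _)
  rw [PiLp.norm_sq_eq_of_L2, PiLp.norm_sq_eq_of_L2]
  refine Finset.sum_le_sum fun x _ => ?_
  gcongr
  refine Lp.norm_le_norm_of_ae_le ?_
  filter_upwards [hF.grad_apply_ae (μ := μ) x,
    (hF.comp_left hj hj0).grad_apply_ae (μ := μ) x] with φ h1 h2
  rw [h1, h2, hF.pderiv_comp_left hj, norm_mul]
  exact mul_le_of_le_one_left (norm_nonneg _) (hj1 _)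

/-- Apply smooth contractions `j n` to `C_c^2` approximants `F n` of `u`. The functions converge
strongly to `v`, while the gradients are merely bounded by those of `F n`; a weak limit supplies the
gradient of `v` with the required bound. -/
theorem HasPosDensity.isMarkovian (h : HasPosDensity s ρ μ) : (closedForm μ).IsMarkovian := by
  intro u v hv
  have hfun := isFunctional_closure_gradGraph h
  set g := op (gradGraph μ).topologicalClosure u with hg
  have hm : ((u : Lp ℝ 2 μ), g) ∈ closure (gradGraph μ : Set (Lp ℝ 2 μ × GradSpace μ)) :=
    mem_graph hfun u
  obtain ⟨z, hz, hzt⟩ := mem_closure_iff_seq_limit.1 hm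
  choose F hF hzF hzG using hz
  have hz2 : ∀ n, (z n).2 = (hF n).grad μ := fun n => by
    ext1 x
    exact Lp.ext ((hzG n x).trans ((hF n).grad_apply_ae x).symm)
  let a : ℕ → ℝ := fun n => 1 / ((n : ℝ) + 1)
  have ha0 : ∀ n, 0 < a n := fun n => by positivity
  have ha : Tendsto a atTop (𝓝 0) := tendsto_one_div_add_atTop_nhds_zero_nat
  choose j hj hj0 hj1 hjε using fun n => exists_smooth_unit_contraction (ha0 n)
  have hJ : ∀ n, IsCc 2 (j n ∘ F n) := fun n => (hF n).comp_left (hj n) (hj0 n)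
  have t1 : Tendsto (fun n => (z n).1) atTop (𝓝 (u : Lp ℝ 2 μ)) :=
    (continuous_fst.tendsto _).comp hzt
  have t2 : Tendsto (fun n => (z n).2) atTop (𝓝 g) := (continuous_snd.tendsto _).comp hzt
  have hlim : Tendsto (fun n => ((hJ n).memLp μ).toLp) atTop (𝓝 v) := by
    rw [tendsto_iff_norm_sub_tendsto_zero]
    have hb : ∀ n, ‖((hJ n).memLp μ).toLp - v‖ ≤ ‖a n • one μ + |(z n).1 - u|‖ := by
      intro n
      refine Lp.norm_le_norm_of_ae_le ?_
      filter_upwards [hv, hzF n, ((hJ n).memLp μ).coeFn_toLp, one_ae (m := μ),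
        Lp.coeFn_sub ((hJ n).memLp μ).toLp v, Lp.coeFn_add (a n • one μ) |(z n).1 - u|,
        Lp.coeFn_smul (a n) (one μ), Lp.coeFn_abs ((z n).1 - (u : Lp ℝ 2 μ)),
        Lp.coeFn_sub (z n).1 (u : Lp ℝ 2 μ)] with φ h1 h2 h3 h4 h5 h6 h7 h8 h9
      rw [h5, h6, Pi.sub_apply, Pi.add_apply, h7, h8, h9, Pi.sub_apply, Pi.smul_apply, h4, h3, h1,
        h2, smul_eq_mul, mul_one, Real.norm_eq_abs,
        Real.norm_of_nonneg (add_nonneg (ha0 n).le (abs_nonneg _))]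
      -- Compare both with the exact unit contraction of `F n φ`: the errors are `a n` and, by the
      -- Lipschitz bound, `|F n φ - u φ|`.
      refine (abs_sub_le _ (min (max (F n φ) 0) 1) _).trans (add_le_add (hjε n _) ?_)
      exact abs_unit_contraction_sub_le _ _
    refine squeeze_zero (fun _ => norm_nonneg _)
      (fun n => (hb n).trans (norm_add_le _ _)) ?_
    have l1 : Tendsto (fun n => ‖a n • one μ‖) atTop (𝓝 0) := by
      simpa using (ha.smul_const (one μ)).norm
    have l2 : Tendsto (fun n => ‖(|(z n).1 - (u : Lp ℝ 2 μ)|)‖) atTop (𝓝 0) := by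
      simp only [norm_abs_eq_norm]
      exact tendsto_iff_norm_sub_tendsto_zero.1 t1
    simpa using l1.add l2
  obtain ⟨k, hk, hkn⟩ := exists_mem_of_bounded
    (Submodule.isClosed_topologicalClosure (gradGraph μ))
    (z := fun n => (((hJ n).memLp μ).toLp, (hJ n).grad μ))
    (fun n => Submodule.le_topologicalClosure _ (hJ n).mem_gradGraph) hlim
    (c := fun n => ‖(z n).2‖)
    (fun n => by
      rw [hz2 n]
      exact norm_grad_comp_le (hF n) (hj n) (hj0 n) (hj1 n)) t2.norm
  refine ⟨mem_ofGraph_domain.2 ⟨k, hk⟩, ?_⟩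
  have e : op (gradGraph μ).topologicalClosure ⟨v, mem_ofGraph_domain.2 ⟨k, hk⟩⟩ = k :=
    op_eq hfun hk
  rw [ofGraph_form_self, ofGraph_form_self, e]
  gcongr

theorem HasPosDensity.isSymmDirichletForm (h : HasPosDensity s ρ μ) :
    (closedForm μ).IsSymmDirichletForm where
  denselyDefined := preForm_isDenselyDefined.mono h.isClosureOf.le
  symm := ofGraph_isSymm
  positive := ofGraph_isPositive
  closed := h.isClosureOf.closed
  markovian := h.isMarkovian

theorem HasPosDensity.isRegular (h : HasPosDensity s ρ μ) : (closedForm μ).IsRegular where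
  fullSupport := h.isOpenPosMeasure
  dense_domain u ε hε := by
    obtain ⟨w, hw⟩ := h.isClosureOf.dense u
    obtain ⟨k, hk⟩ := (hw.eventually (gt_mem_nhds hε)).exists
    obtain ⟨F, hF, hwF⟩ := mem_preForm_domain.1 (w k).2
    exact ⟨Submodule.inclusion h.isClosureOf.le (w k),
      ⟨⟨F, hF.continuous⟩, hF.compactSupport⟩, hwF, hk⟩
  dense_continuous f ε hε := by
    obtain ⟨F, hF, hfF⟩ := exists_isCc_approx f.continuous f.hasCompactSupport hε
    exact ⟨Submodule.inclusion h.isClosureOf.le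
      ⟨_, mem_preForm_domain.2 ⟨F, hF, (hF.memLp μ).coeFn_toLp⟩⟩,
      ⟨⟨F, hF.continuous⟩, hF.compactSupport⟩, (hF.memLp μ).coeFn_toLp, hfF⟩

/-- The gradient of `u` vanishes a.e. off `supp u`, that of `v` a.e. on `U ⊇ supp u`, so their
product vanishes a.e. -/
theorem HasPosDensity.isStronglyLocal (h : HasPosDensity s ρ μ) :
    (closedForm μ).IsStronglyLocal := by
  rintro u v - - ⟨U, c, hU, hsub, hc⟩
  have hfun := isFunctional_closure_gradGraph h
  have hu := mem_graph hfun u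
  have hv := mem_graph hfun v
  rw [ofGraph_form, PiLp.inner_apply]
  refine Finset.sum_eq_zero fun x _ => ?_
  have h1 := grad_eq_zero_of_const h hv hU hc x
  have h2 : ∀ᵐ φ ∂(μ.restrict (posSet x)), φ ∉ supp (u : Lp ℝ 2 μ) →
      op (gradGraph μ).topologicalClosure u x φ = 0 := by
    rw [ae_iff]
    -- The complement of `supp u` is covered by open sets on which `u = 0` a.e.; second countability
    -- makes a locally null set null.
    refine measure_null_of_locally_null _ fun φ hφ => ?_
    simp only [Classical.not_imp, mem_ofPred_eq] at hφ
    have hφ1 := hφ.1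
    simp only [supp, mem_ofPred_eq, not_forall, not_not] at hφ1
    obtain ⟨O, hO, hφO, hu0⟩ := hφ1
    have h3 := grad_eq_zero_of_const h hu hO hu0 x
    rw [ae_iff] at h3
    refine ⟨_, inter_mem_nhdsWithin _ (hO.mem_nhds hφO), measure_mono_null ?_ h3⟩
    rintro ψ ⟨hψ, hψO⟩
    simp only [Classical.not_imp, mem_ofPred_eq] at hψ ⊢
    exact ⟨hψO, hψ.2⟩
  rw [L2.inner_def]
  refine integral_eq_zero_of_ae ?_
  filter_upwards [h1, h2] with φ h3 h4
  by_cases hφ : φ ∈ supp (u : Lp ℝ 2 μ)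
  · have := h3 (hsub hφ)
    simp [this]
  · simp [h4 hφ]

theorem HasPosDensity.isConservative (h : HasPosDensity s ρ μ) :
    (closedForm μ).IsConservative := by
  obtain ⟨g, hg0, hone⟩ : ∃ g : GradSpace μ, ‖g‖ = 0 ∧
      (one μ, g) ∈ (gradGraph μ).topologicalClosure := ⟨0, norm_zero, one_mem_closure⟩
  obtain ⟨e, he⟩ : ∃ e : (closedForm μ).domain, (e : Lp ℝ 2 μ) = one μ :=
    ⟨⟨one μ, mem_ofGraph_domain.2 ⟨g, hone⟩⟩, rfl⟩
  have hmem : ((e : Lp ℝ 2 μ), g) ∈ (gradGraph μ).topologicalClosure := by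
    rw [he]
    exact hone
  have hfun := isFunctional_closure_gradGraph h
  have hop : op (gradGraph μ).topologicalClosure e = g := op_eq hfun hmem
  have h0 : (closedForm μ).form e e = 0 := by
    rw [ofGraph_form_self, hop, hg0, zero_pow two_ne_zero]
  exact ⟨e, by rw [he]; exact one_ae, h0, fun T hT t ht => hT.apply_eq_self _ h0 t ht⟩

end DirichletForm

/-! ### Finiteness of the partition function -/

section PartitionFunction

/-- A product of functions that can be integrated out one variable at a time, in decreasing order
of `f`, has bounded marginals. -/
theorem lmarginal_prod_le {ι X : Type*} [DecidableEq ι] [MeasurableSpace X] {ν : Measure X}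
    [SigmaFinite ν] {T : ι → (ι → X) → ℝ≥0∞} (hT : ∀ x, Measurable (T x)) (f : ι → ℤ)
    (hdep : ∀ x y, x ≠ y → f x ≤ f y → ∀ φ t, T x (Function.update φ y t) = T x φ) {K : ℝ≥0∞}
    (hK : ∀ x φ, ∫⁻ t, T x (Function.update φ x t) ∂ν ≤ K) (S : Finset ι) (φ : ι → X) :
    (∫⋯∫⁻_S, (fun φ => ∏ x ∈ S, T x φ) ∂(fun _ => ν)) φ ≤ K ^ S.card := by
  induction S using Finset.induction_on_max_value f generalizing φ with
  | empty => simp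
  | insert a S haS hmax ih =>
    have hm : Measurable fun φ => ∏ x ∈ insert a S, T x φ :=
      Finset.measurable_fun_prod _ fun x _ => hT x
    have hm' : Measurable fun φ => ∏ x ∈ S, T x φ := Finset.measurable_fun_prod _ fun x _ => hT x
    rw [lmarginal_insert' _ hm haS]
    have h1 : (fun φ => ∫⁻ t, ∏ x ∈ insert a S, T x (Function.update φ a t) ∂ν) ≤
        fun φ => (∏ x ∈ S, T x φ) * K := by
      intro φ
      -- As `a` maximizes `f`, no factor indexed by `S` depends on `φ a`, so all of them leave the
      -- inner integral.
      have h2 : ∀ t, ∏ x ∈ insert a S, T x (Function.update φ a t) =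
          (∏ x ∈ S, T x φ) * T a (Function.update φ a t) := by
        intro t
        rw [Finset.prod_insert haS, mul_comm]
        congr 1
        refine Finset.prod_congr rfl fun x hx => hdep x a ?_ (hmax x hx) φ t
        rintro rfl
        exact haS hx
      simp only [h2]
      rw [lintegral_const_mul (∏ x ∈ S, T x φ) (f := fun t => T a (Function.update φ a t))
        ((hT a).comp (measurable_update φ))]
      gcongr
      exact hK a φ
    refine (lmarginal_mono h1 φ).trans ?_
    have h3 : (∫⋯∫⁻_S, (fun φ => (∏ x ∈ S, T x φ) * K) ∂(fun _ => ν)) φ =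
        (∫⋯∫⁻_S, (fun φ => ∏ x ∈ S, T x φ) ∂(fun _ => ν)) φ * K :=
      lintegral_mul_const _ (hm'.comp measurable_updateFinset)
    rw [h3, Finset.card_insert_of_notMem haS, pow_succ]
    gcongr
    exact ih φ

/-- One-dimensional integrals against the single-site measure are bounded uniformly in shifts. -/
theorem lintegral_siteMeasure_le {s : ℝ} {g : ℝ → ℝ≥0∞} (h1 : ∀ r, g r ≤ 1)
    (c : ℝ) : ∫⁻ t : ℝ≥0, g (t - c) ∂(siteMeasure s) ≤ ENNReal.ofReal s + ∫⁻ r, g r := by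
  rw [siteMeasure, lintegral_add_measure, lintegral_smul_measure, lintegral_dirac]
  gcongr
  · rw [smul_eq_mul]
    exact mul_le_of_le_one_right' (h1 _)
  · have h2 : ∫⁻ t : ℝ≥0, g (t - c) ∂halfLineLebesgue =
        ∫⁻ t in Ici (0 : ℝ), g (t - c) := by
      rw [← map_halfLineLebesgue, measurableEmbedding_coe.lintegral_map]
    rw [h2]
    refine (setLIntegral_le_lintegral _ _).trans (le_of_eq ?_)
    exact lintegral_sub_right_eq_self g c

variable {d N : ℕ}

theorem continuous_height (x : Fin d → ℤ) : Continuous fun φ : Interface d N => height φ x := by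
  unfold height
  split_ifs <;> fun_prop

theorem continuous_hamiltonian {V : ℝ → ℝ} (hV : Continuous V) :
    Continuous (hamiltonian d N V) := by
  unfold hamiltonian
  have h := continuous_height (d := d) (N := N)
  fun_prop

theorem nbr_comm {x y : Fin d → ℤ} : Nbr x y ↔ Nbr y x := by
  unfold Nbr
  simp only [sub_sq_comm]

theorem nbr_sub_single (x : Fin d → ℤ) (i : Fin d) : Nbr x (x - Pi.single i 1) := by
  unfold Nbr
  simp [Pi.single_apply]

theorem sub_single_mem_closedBox {x : Fin d → ℤ} (hx : x ∈ box d N) (i : Fin d) :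
    x - Pi.single i 1 ∈ closedBox d N := by
  unfold closedBox
  rw [Finset.mem_union]
  by_cases h : x - Pi.single i 1 ∈ box d N
  · exact Or.inl h
  · exact Or.inr ((mem_boundary _).2 ⟨h, x, hx, nbr_comm.1 (nbr_sub_single x i)⟩)

/-- The Hamiltonian dominates the sum over the bonds in one coordinate direction. -/
theorem le_hamiltonian {V : ℝ → ℝ} {b : ℝ} (hb : ∀ r, -b ≤ V r) (hs : ∀ r, V (-r) = V r)
    (i : Fin d) : ∃ C : ℝ, ∀ φ : Interface d N,
      ∑ x ∈ box d N, (V (height φ x - height φ (x - Pi.single i 1)) + b) - C ≤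
        hamiltonian d N V φ := by
  let S : Finset ((Fin d → ℤ) × (Fin d → ℤ)) :=
    (closedBox d N ×ˢ closedBox d N).filter fun p => Nbr p.1 p.2
  -- The constant pays for adding `b` to each ordered bond.
  refine ⟨1 / 2 * (S.card * b), fun φ => ?_⟩
  let W : (Fin d → ℤ) × (Fin d → ℤ) → ℝ := fun p => V (height φ p.1 - height φ p.2)
  have hH : hamiltonian d N V φ = 1 / 2 * ∑ p ∈ S, W p := by
    unfold hamiltonian
    simp only [S, W, Finset.sum_filter, Finset.sum_product]
  -- Each bond in direction `i` occurs in both orientations; by symmetry of `V` they contribute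
  -- equally, cancelling the factor `1 / 2`.
  let f₁ : (Fin d → ℤ) → (Fin d → ℤ) × (Fin d → ℤ) := fun x => (x, x - Pi.single i 1)
  let f₂ : (Fin d → ℤ) → (Fin d → ℤ) × (Fin d → ℤ) := fun x => (x - Pi.single i 1, x)
  have hf₁ : Function.Injective f₁ := fun x y h => (Prod.ext_iff.1 h).1
  have hf₂ : Function.Injective f₂ := fun x y h => (Prod.ext_iff.1 h).2
  have hdisj : Disjoint ((box d N).image f₁) ((box d N).image f₂) := by
    rw [Finset.disjoint_left]
    rintro p hp₁ hp₂
    obtain ⟨x, -, rfl⟩ := Finset.mem_image.1 hp₁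
    obtain ⟨y, -, hy⟩ := Finset.mem_image.1 hp₂
    have h1 := congrFun (Prod.ext_iff.1 hy).1 i
    have h2 := congrFun (Prod.ext_iff.1 hy).2 i
    simp [f₁, f₂] at h1 h2
    omega
  have hsub : (box d N).image f₁ ∪ (box d N).image f₂ ⊆ S := by
    intro p hp
    have hcb : ∀ x ∈ box d N, x ∈ closedBox d N := fun x hx => Finset.mem_union_left _ hx
    rcases Finset.mem_union.1 hp with hp | hp <;> obtain ⟨x, hx, rfl⟩ := Finset.mem_image.1 hp
    · exact Finset.mem_filter.2 ⟨Finset.mem_product.2 ⟨hcb x hx, sub_single_mem_closedBox hx i⟩,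
        nbr_sub_single x i⟩
    · exact Finset.mem_filter.2 ⟨Finset.mem_product.2 ⟨sub_single_mem_closedBox hx i, hcb x hx⟩,
        nbr_comm.1 (nbr_sub_single x i)⟩
  -- After the shift by `b` all terms are nonnegative, so the other bonds can be dropped.
  have hle := Finset.sum_le_sum_of_subset_of_nonneg (f := fun p => W p + b) hsub
    fun p _ _ => by linarith [hb (height φ p.1 - height φ p.2)]
  rw [Finset.sum_union hdisj, Finset.sum_image hf₁.injOn, Finset.sum_image hf₂.injOn,
    Finset.sum_add_distrib (s := S), Finset.sum_const, nsmul_eq_mul] at hle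
  have e2 : ∑ x ∈ box d N, (W (f₂ x) + b) = ∑ x ∈ box d N, (W (f₁ x) + b) := by
    refine Finset.sum_congr rfl fun x _ => ?_
    simp only [W, f₁, f₂]
    rw [← hs, neg_sub]
  rw [e2] at hle
  rw [hH]
  change ∑ x ∈ box d N, (W (f₁ x) + b) - _ ≤ _
  linarith

/-- Up to a constant, `exp (-H)` is at most a product with one factor `g (φ_x - φ_{x-e})` per site.
Integrating out one site costs at most `K`, whatever the height of its predecessor. -/
theorem partitionFunction_ne_top (hd : 1 ≤ d) {s : ℝ} {V : ℝ → ℝ}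
    (hV : IsPairPotential d N s V) : partitionFunction d N s V ≠ ∞ := by
  obtain ⟨b, -, hb⟩ := hV.bounded_below
  have hVc : Continuous V := hV.contDiff.continuous
  let i : Fin d := ⟨0, hd⟩
  obtain ⟨C, hC⟩ := le_hamiltonian (N := N) hb hV.symm i
  -- The shift by `b` ensures `g ≤ 1`, which bounds the contribution of the atom by `s`.
  let g : ℝ → ℝ≥0∞ := fun r => ENNReal.ofReal (Real.exp (-(V r + b)))
  have hgm : Measurable g := by
    have : Continuous fun r => Real.exp (-(V r + b)) := by fun_prop
    exact this.measurable.ennreal_ofReal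
  have hg1 : ∀ r, g r ≤ 1 := fun r => by
    simp only [g]
    rw [ENNReal.ofReal_le_one, Real.exp_le_one_iff]
    linarith [hb r]
  let K : ℝ≥0∞ := ENNReal.ofReal s + ∫⁻ r, g r
  have hK : K ≠ ∞ := by
    refine ENNReal.add_ne_top.2 ⟨ENNReal.ofReal_ne_top, ?_⟩
    have hi : Integrable fun r => Real.exp (-(V r + b)) := by
      refine (hV.integrable.mul_const (Real.exp (-b))).congr (Eventually.of_forall fun r => ?_)
      simp only
      rw [← Real.exp_add]
      congr 1
      ring
    exact hi.lintegral_lt_top.ne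
  let T : ↥(box d N) → Interface d N → ℝ≥0∞ := fun x φ =>
    g (height φ x.1 - height φ (x.1 - Pi.single i 1))
  have hT : ∀ x, Measurable (T x) := fun x =>
    hgm.comp ((continuous_height _).sub (continuous_height _)).measurable
  have hupd : ∀ (φ : Interface d N) (y : ↥(box d N)) t (z : Fin d → ℤ), z ≠ y.1 →
      height (Function.update φ y t) z = height φ z := by
    intro φ y t z hz
    unfold height
    split_ifs with h
    · rw [Function.update_of_ne]
      rintro rfl
      exact hz rfl
    · rfl
  have hne : ∀ x : Fin d → ℤ, x - Pi.single i 1 ≠ x := fun x h => by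
    have := congrFun h i
    simp at this
  -- The factor at `x` involves only `x` and `x - e`; a site `y ≠ x` with `x i ≤ y i` is neither.
  have hbound := lmarginal_prod_le (ν := siteMeasure s) hT (fun x => x.1 i)
    (fun x y hxy hle φ t => by
      simp only [T]
      rw [hupd φ y t x.1 fun h => hxy (Subtype.ext h), hupd φ y t _ fun h => ?_]
      have := congrFun h i
      simp at this
      omega) (K := K)
    (fun x φ => by
      have e : ∀ t : ℝ≥0, T x (Function.update φ x t) =
          g (t - height φ (x.1 - Pi.single i 1)) := fun t => by
        simp only [T]
        rw [hupd φ x t _ (hne x.1)]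
        congr 2
        simp [height]
      simp only [e]
      exact lintegral_siteMeasure_le hg1 _) Finset.univ 0
  rw [← lintegral_eq_lmarginal_univ] at hbound
  have hle : ∀ φ : Interface d N, ENNReal.ofReal (Real.exp (-hamiltonian d N V φ)) ≤
      ENNReal.ofReal (Real.exp C) * ∏ x, T x φ := by
    intro φ
    simp only [T, g]
    rw [← ENNReal.ofReal_prod_of_nonneg fun _ _ => (Real.exp_pos _).le, ← Real.exp_sum,
      ← ENNReal.ofReal_mul (Real.exp_pos _).le, ← Real.exp_add]
    refine ENNReal.ofReal_le_ofReal (Real.exp_le_exp.2 ?_)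
    have h1 := hC φ
    rw [← Finset.sum_coe_sort] at h1
    rw [Finset.sum_neg_distrib]
    linarith
  have hfin : partitionFunction d N s V ≤
      ENNReal.ofReal (Real.exp C) * K ^ (Finset.univ : Finset ↥(box d N)).card := by
    refine (lintegral_mono hle).trans ?_
    rw [lintegral_const_mul _ (Finset.measurable_fun_prod _ fun x _ => hT x)]
    gcongr
    exact hbound
  exact (hfin.trans_lt (ENNReal.mul_lt_top ENNReal.ofReal_lt_top
    (ENNReal.pow_lt_top hK.lt_top))).ne

theorem partitionFunction_ne_zero {s : ℝ} {V : ℝ → ℝ} (hV : Continuous V) :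
    partitionFunction d N s V ≠ 0 := by
  have hm : Measurable fun φ : Interface d N =>
      ENNReal.ofReal (Real.exp (-hamiltonian d N V φ)) :=
    (Real.continuous_exp.comp (continuous_hamiltonian hV).neg).measurable.ennreal_ofReal
  refine ((lintegral_pos_iff_support hm).2 ?_).ne'
  have h : Function.support (fun φ : Interface d N =>
      ENNReal.ofReal (Real.exp (-hamiltonian d N V φ))) = univ := by
    ext φ
    simp [Real.exp_pos]
  rw [h]
  exact isOpen_univ.measure_pos (piRef ↥(box d N) s) univ_nonempty

/-- The density of the Gibbs measure. -/
def gibbsDensity (d N : ℕ) (s : ℝ) (V : ℝ → ℝ) (φ : Interface d N) : ℝ :=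
  Real.exp (-hamiltonian d N V φ) / (partitionFunction d N s V).toReal

theorem IsPairPotential.hasPosDensity (hd : 1 ≤ d) {s : ℝ} {V : ℝ → ℝ}
    (hV : IsPairPotential d N s V) :
    HasPosDensity s (gibbsDensity d N s V) (gibbs d N s V) where
  continuous := by
    have := continuous_hamiltonian (d := d) (N := N) hV.contDiff.continuous
    unfold gibbsDensity
    fun_prop
  pos φ := div_pos (Real.exp_pos _) (ENNReal.toReal_pos
    (partitionFunction_ne_zero hV.contDiff.continuous) (partitionFunction_ne_top hd hV))
  eq := by
    have hZ : 0 < (partitionFunction d N s V).toReal := ENNReal.toReal_pos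
      (partitionFunction_ne_zero hV.contDiff.continuous) (partitionFunction_ne_top hd hV)
    have h : (fun φ : Interface d N => ENNReal.ofReal (gibbsDensity d N s V φ)) = fun φ =>
        ENNReal.ofReal (Real.exp (-hamiltonian d N V φ)) / partitionFunction d N s V := by
      funext φ
      rw [gibbsDensity, ENNReal.ofReal_div_of_pos hZ,
        ENNReal.ofReal_toReal (partitionFunction_ne_top hd hV)]
    rw [h]
    rfl

theorem IsPairPotential.isProbabilityMeasure_gibbs (hd : 1 ≤ d) {s : ℝ} {V : ℝ → ℝ}
    (hV : IsPairPotential d N s V) : IsProbabilityMeasure (gibbs d N s V) where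
  measure_univ := by
    rw [gibbs, withDensity_apply _ MeasurableSet.univ, Measure.restrict_univ]
    simp only [div_eq_mul_inv]
    have hm : Measurable fun φ : Interface d N =>
        ENNReal.ofReal (Real.exp (-hamiltonian d N V φ)) :=
      (Real.continuous_exp.comp
        (continuous_hamiltonian hV.contDiff.continuous).neg).measurable.ennreal_ofReal
    rw [lintegral_mul_const _ hm]
    exact ENNReal.mul_inv_cancel (partitionFunction_ne_zero hV.contDiff.continuous)
      (partitionFunction_ne_top hd hV)

end PartitionFunction

/-! ### The wetting form -/

section WettingForm

variable {d N : ℕ}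

theorem measurableSet_wet (B : Finset ↥(box d N)) : MeasurableSet (wet B) := by
  have h : wet B = ⋂ x, if x ∈ B then posSet x else (posSet x)ᶜ := by
    ext φ
    simp only [wet, mem_ofPred_eq, mem_iInter]
    refine forall_congr' fun x => ?_
    by_cases hx : x ∈ B <;> simp [hx, posSet]
  rw [h]
  refine MeasurableSet.iInter fun x => ?_
  split_ifs
  · exact measurableSet_posSet x
  · exact (measurableSet_posSet x).compl

theorem disjoint_wet {B C : Finset ↥(box d N)} (h : B ≠ C) : Disjoint (wet B) (wet C) := by
  rw [Set.disjoint_left]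
  intro φ hB hC
  exact h (Finset.ext fun x => (hB x).symm.trans (hC x))

theorem biUnion_wet (x : ↥(box d N)) :
    ⋃ B ∈ (Finset.univ : Finset (Finset ↥(box d N))).filter (fun B => x ∈ B), wet B =
      posSet x := by
  ext φ
  simp only [Finset.mem_filter, Finset.mem_univ, true_and, mem_iUnion, exists_prop]
  constructor
  · rintro ⟨B, hx, hφ⟩
    exact (hφ x).2 hx
  · intro hφ
    exact ⟨Finset.univ.filter fun y => 0 < φ y, by simpa [posSet] using hφ, fun y => by simp⟩

/-- Exchange the sums: for fixed `x`, the sets `wet B` with `x ∈ B` partition `posSet x`. The empty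
`B` contributes an empty sum. -/
theorem wettingEnergy_eq {s : ℝ} {V : ℝ → ℝ} {F G : Interface d N → ℝ}
    (hi : ∀ x, Integrable (fun φ => pderiv x F φ * pderiv x G φ) (gibbs d N s V)) :
    wettingEnergy d N s V F G =
      ∑ x, ∫ φ in posSet x, pderiv x F φ * pderiv x G φ ∂(gibbs d N s V) := by
  have h1 : wettingEnergy d N s V F G = ∑ B : Finset ↥(box d N),
      ∑ x ∈ B, ∫ φ in wet B, pderiv x F φ * pderiv x G φ ∂(gibbs d N s V) := by
    unfold wettingEnergy
    refine Finset.sum_subset (Finset.filter_subset _ _) fun B _ hB => ?_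
    have : B = ∅ := by simpa using hB
    rw [this, Finset.sum_empty]
  rw [h1, Finset.sum_comm' (t' := Finset.univ)
    (s' := fun x => Finset.univ.filter fun B : Finset ↥(box d N) => x ∈ B) (by simp)]
  refine Finset.sum_congr rfl fun x _ => ?_
  rw [← biUnion_wet x, integral_biUnion_finset _ (fun B _ => measurableSet_wet B)
    (fun B _ C _ h => disjoint_wet h) fun B _ => (hi x).integrableOn]

theorem IsPairPotential.isWettingForm (hd : 1 ≤ d) {s : ℝ} {V : ℝ → ℝ}
    (hV : IsPairPotential d N s V) : IsWettingForm d N s V (preForm (gibbs d N s V)) := by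
  have := hV.isProbabilityMeasure_gibbs hd
  have hi : ∀ F G : Interface d N → ℝ, IsCc 2 F → IsCc 2 G → ∀ x,
      Integrable (fun φ => pderiv x F φ * pderiv x G φ) (gibbs d N s V) := fun F G hF hG x =>
    ((hF.continuous_pderiv x).mul (hG.continuous_pderiv x)).integrable_of_hasCompactSupport
      (hF.hasCompactSupport_pderiv x).mul_right
  exact
    { memLp := fun F hF => hF.memLp _
      mem_domain := fun u => mem_preForm_domain
      integrable := fun F G hF hG B x _ => (hi F G hF hG x).integrableOn
      form_eq := fun F G hF hG u v hu hv => by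
        rw [wettingEnergy_eq (hi F G hF hG)]
        exact (hV.hasPosDensity hd).preForm_apply hF hG u v hu hv }

end WettingForm

end Wetting

end

theorem mainTheorem10 (d N : ℕ) (hd : 1 ≤ d) (hN : 1 ≤ N) (s : ℝ) (hs : 0 < s)
    (V : ℝ → ℝ) (hV : Wetting.IsPairPotential d N s V) :
    IsProbabilityMeasure (Wetting.gibbs d N s V) ∧
    ∃ 𝓔 : Wetting.L2Form (Wetting.gibbs d N s V), Wetting.IsWettingForm d N s V 𝓔 ∧
      𝓔.IsDenselyDefined ∧ 𝓔.IsPositive ∧ 𝓔.IsSymm ∧ 𝓔.IsClosable ∧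
      ∃ 𝓕 : Wetting.L2Form (Wetting.gibbs d N s V), 𝓕.IsClosureOf 𝓔 ∧
        𝓕.IsSymmDirichletForm ∧ 𝓕.IsRegular ∧ 𝓕.IsStronglyLocal ∧ 𝓕.IsConservative := by
  have hprob := hV.isProbabilityMeasure_gibbs hd
  have h := hV.hasPosDensity hd
  have hfun := Wetting.isFunctional_closure_gradGraph h
  exact ⟨hprob, Wetting.preForm _, hV.isWettingForm hd, Wetting.preForm_isDenselyDefined,
    Wetting.L2Form.ofGraph_isPositive, Wetting.L2Form.ofGraph_isSymm,
    Wetting.L2Form.ofGraph_isClosable hfun, Wetting.closedForm _, h.isClosureOf,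
    h.isSymmDirichletForm, h.isRegular, h.isStronglyLocal, h.isConservative⟩
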